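/- A compact connected oriented smooth surface with nonempty boundary is called admissible if it is neither a disk nor an annulus. A 4-dimensional graph-manifold $M$ is a closed oriented 4-manifold glued from finitely many blocks $M_v=\Phi_v\times T^2$, $v\in V$, with $\Phi_v$ admissible, as follows: all the boundary tori of the blocks are paired, and the two tori of each pair are glued by a diffeomorphism that reverses the boundary orientations and does not identify the fibre subgroups described below. Its graph has the blocks as vertices and the pairs of glued tori as edges; a directed edge $w$ starting at $v$ (written $w\in\partial v$) corresponds to a boundary torus $T_w=\gamma_w\times T^2$ of $M_v$, where $\gamma_w$ is a component of $\partial\Phi_v$ with the boundary orientation, and $-w$ is the reversed edge. Let $L_w=H_1(T_w;\mathbb Z)\cong\mathbb Z^3$, $F_v=H_1(T^2;\mathbb Z)\cong\mathbb Z^2$ for the fibre of $M_v$, and let $F_w\subset L_w$ be the image of $F_v$. The gluing induces isomorphisms $\widehat g_w:L_{-w}\to L_w$, $\widehat g_{-w}=\widehat g_w^{-1}$, and it is required that $\widehat g_w(F_{-w})\ne F_w$. A trivialization of the fibration $M_v\to\Phi_v$, that is, a diffeomorphism $\Phi_v\times S^1\times S^1\to M_v$ over $\mathrm{id}_{\Phi_v}$,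 induces a basis $(z_w,f^1_w,f^2_w)$ of $L_w$ for each $w\in\partial v$: $z_w$ is the class of $\gamma_w$, and $f_w^1,f_w^2$ are the classes of the two circle factors. * The intersection number of $w$ is the greatest common divisor of the $z_w$-coordinates of $\widehat g_w(f^1_{-w})$ and $\widehat g_w(f^2_{-w})$. * The intersection lattice of $w\in\partial v$ is $P_w=F_w\cap\widehat g_w(F_{-w})$, regarded as a subgroup of $F_v$. The type of the block $M_v$ is the number of distinct subgroups among the $P_w$, $w\in\partial v$. * The secondary intersection number of a block $M_v$ of type 2 is the index in $F_v$ of the subgroup generated by all $P_w$, $w\in\partial v$. * $M$ is orthogonal if the blocks have trivializations such that for every directed edge $w$ the bases $\widehat g_w(z_{-w},f^1_{-w},f^2_{-w})$ and $(z_w,f^1_w,f^2_w)$ of $L_w$ differ only by a permutation of the elements and by signs. **Corollary.** There exists a 4-dimensional graph-manifold that is not orthogonal, although all its blocks have type 2, all its intersection numbers are equal to 1, and all its secondary intersection numbers are equal to 1. Moreover, for every $k\ge 3$ such a graph-manifold can be found whose graph is a cycle of length $k$, all of whose blocks are (torus with two holes)$\,\times T^2$, and which is obtained from an orthogonal graph-manifold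 with the same blocks by changing the gluing along a single edge. -/

import Mathlib

open scoped Manifold ContDiff

noncomputable section

/-! ### First singular homology with integer coefficients -/

/-- Singular `n`-chains of `X`: the free abelian group on continuous maps `Δⁿ → X`. -/
abbrev SingularChain (n : ℕ) (X : Type) [TopologicalSpace X] : Type :=
  FreeAbelianGroup C(stdSimplex ℝ (Fin (n + 1)), X)

/-- The `i`-th face inclusion `Δⁿ → Δⁿ⁺¹`, onto the face opposite to the `i`-th vertex. -/
def simplexFace (n : ℕ) (i : Fin (n + 2)) :
    C(stdSimplex ℝ (Fin (n + 1)), stdSimplex ℝ (Fin (n + 2))) :=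
  ⟨stdSimplex.map (Fin.succAbove i), stdSimplex.continuous_map _⟩

/-- The singular boundary operator `∂ σ = ∑ i, (-1)ⁱ σ ∘ dⁱ`. -/
def singularBoundary (n : ℕ) (X : Type) [TopologicalSpace X] :
    SingularChain (n + 1) X →+ SingularChain n X :=
  FreeAbelianGroup.lift fun σ =>
    ∑ i : Fin (n + 2), (-1 : ℤ) ^ (i : ℕ) • FreeAbelianGroup.of (σ.comp (simplexFace n i))

/-- The group of singular `1`-cycles. -/
abbrev SingularCycle (X : Type) [TopologicalSpace X] : AddSubgroup (SingularChain 1 X) :=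
  (singularBoundary 0 X).ker

/-- `H₁(X; ℤ)`: singular `1`-cycles modulo boundaries of singular `2`-chains. -/
abbrev H1 (X : Type) [TopologicalSpace X] : Type :=
  SingularCycle X ⧸ (singularBoundary 1 X).range.addSubgroupOf (SingularCycle X)

/-- The map on singular chains induced by a continuous map. -/
def singularChainMap (n : ℕ) {X Y : Type} [TopologicalSpace X] [TopologicalSpace Y]
    (f : C(X, Y)) : SingularChain n X →+ SingularChain n Y :=
  FreeAbelianGroup.map fun σ => f.comp σ

theorem singularBoundary_chainMap (n : ℕ) {X Y : Type} [TopologicalSpace X] [TopologicalSpace Y]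
    (f : C(X, Y)) (c : SingularChain (n + 1) X) :
    singularBoundary n Y (singularChainMap (n + 1) f c) =
      singularChainMap n f (singularBoundary n X c) := by
  have h : (singularBoundary n Y).comp (singularChainMap (n + 1) f) =
      (singularChainMap n f).comp (singularBoundary n X) := by
    apply FreeAbelianGroup.lift_ext
    intro σ
    simp only [AddMonoidHom.comp_apply, singularChainMap, singularBoundary,
      FreeAbelianGroup.map_of_apply, FreeAbelianGroup.lift_apply_of, map_sum, map_zsmul]
    rfl
  exact DFunLike.congr_fun h c

/-- The map on singular `1`-cycles induced by a continuous map. -/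
def singularCycleMap {X Y : Type} [TopologicalSpace X] [TopologicalSpace Y] (f : C(X, Y)) :
    SingularCycle X →+ SingularCycle Y :=
  ((singularChainMap 1 f).comp (SingularCycle X).subtype).codRestrict (SingularCycle Y) fun c => by
    have hc : singularBoundary 0 X c.1 = 0 := c.2
    change singularBoundary 0 Y (singularChainMap 1 f c.1) = 0
    rw [singularBoundary_chainMap, hc, map_zero]

/-- The induced homomorphism `f_* : H₁(X; ℤ) → H₁(Y; ℤ)`. -/
def H1.map {X Y : Type} [TopologicalSpace X] [TopologicalSpace Y] (f : C(X, Y)) : H1 X →+ H1 Y :=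
  QuotientAddGroup.map _ _ (singularCycleMap f) (by
    rintro ⟨c, hc⟩ ⟨b, hb⟩
    refine ⟨singularChainMap 2 f b, ?_⟩
    rw [singularBoundary_chainMap, hb]
    rfl)

/-- The singular `1`-simplex `t ↦ γ (exp (2πi t))` of a loop `γ`. -/
def loopSimplex {X : Type} [TopologicalSpace X] (γ : C(Circle, X)) :
    C(stdSimplex ℝ (Fin 2), X) :=
  γ.comp ⟨fun t => Circle.exp (2 * Real.pi * t.1 1),
    Circle.exp.continuous.comp
      (continuous_const.mul ((continuous_apply 1).comp continuous_subtype_val))⟩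

theorem loopSimplex_mem_cycles {X : Type} [TopologicalSpace X] (γ : C(Circle, X)) :
    FreeAbelianGroup.of (loopSimplex γ) ∈ SingularCycle X := by
  have h : (loopSimplex γ).comp (simplexFace 0 0) = (loopSimplex γ).comp (simplexFace 0 1) := by
    ext s
    have hs : s.1 0 = 1 := by simpa using s.2.2
    have h0 : (stdSimplex.map (Fin.succAbove (0 : Fin 2)) s).1 1 = 1 := by
      have : ((FunOnFinite.linearMap ℝ ℝ (Fin.succAbove (0 : Fin 2))) s.1) 1 = 1 := by
        simp [FunOnFinite.linearMap_apply_apply, hs, Finset.filter_true_of_mem]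
      exact this
    have h1 : (stdSimplex.map (Fin.succAbove (1 : Fin 2)) s).1 1 = 0 := by
      have : ((FunOnFinite.linearMap ℝ ℝ (Fin.succAbove (1 : Fin 2))) s.1) 1 = 0 := by
        simp [FunOnFinite.linearMap_apply_apply]
      exact this
    change γ (Circle.exp (2 * Real.pi * (stdSimplex.map (Fin.succAbove (0 : Fin 2)) s).1 1)) =
      γ (Circle.exp (2 * Real.pi * (stdSimplex.map (Fin.succAbove (1 : Fin 2)) s).1 1))
    rw [h0, h1]
    simp
  change singularBoundary 0 X _ = 0
  simp [singularBoundary, Fin.sum_univ_two, h]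

/-- The class in `H₁(X; ℤ)` of a loop `γ : S¹ → X`. -/
def loopClass {X : Type} [TopologicalSpace X] (γ : C(Circle, X)) : H1 X :=
  QuotientAddGroup.mk ⟨FreeAbelianGroup.of (loopSimplex γ), loopSimplex_mem_cycles γ⟩

/-! ### Tori -/

/-- The fibre torus `T² = S¹ × S¹`. -/
abbrev T2 : Type := Circle × Circle

/-- The torus `S¹ × T²`: a boundary circle of the base times the fibre. -/
abbrev T3 : Type := Circle × T2

/-- The smooth model of `T2`. -/
abbrev modelT2 := (𝓡 1).prod (𝓡 1)

/-- The smooth model of `T3`. -/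
abbrev modelT3 := (𝓡 1).prod modelT2

/-- The inclusion of the fibre `T²` in `S¹ × T²`. -/
def fiberInclusion : C(T2, T3) := ⟨fun t => (1, t), by fun_prop⟩

/-- The three coordinate circles of `S¹ × S¹ × S¹`. -/
def coordinateCircle : Fin 3 → C(Circle, T3)
  | 0 => ⟨fun s => (s, (1, 1)), by fun_prop⟩
  | 1 => ⟨fun s => (1, (s, 1)), by fun_prop⟩
  | 2 => ⟨fun s => (1, (1, s)), by fun_prop⟩

/-- The standard basis `(z, f¹, f²)` of `H₁(S¹ × T²; ℤ)`. -/
def torusBasis (j : Fin 3) : H1 T3 := loopClass (coordinateCircle j)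

/-- The fibre subgroup of `H₁(S¹ × T²; ℤ)`. -/
def fiberSubgroup : AddSubgroup (H1 T3) := (H1.map fiberInclusion).range

/-- A diffeomorphism of `S¹ × T²` as a continuous map. -/
def T3map (g : Diffeomorph modelT3 modelT3 T3 T3 ∞) : C(T3, T3) := ⟨g, g.continuous⟩

open Classical in
/-- The integer matrix, in the standard basis `(z, f¹, f²)`, of the automorphism of
`H₁(S¹ × T²; ℤ)` induced by a diffeomorphism: its `j`-th column expands the image of the `j`-th
basis element. (Such a matrix always exists and is unique, `H₁` being free on `torusBasis`.) -/
def homologyMatrix (g : Diffeomorph modelT3 modelT3 T3 T3 ∞) : Matrix (Fin 3) (Fin 3) ℤ :=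
  if h : ∃ A : Matrix (Fin 3) (Fin 3) ℤ,
      ∀ j, H1.map (T3map g) (torusBasis j) = ∑ i, A i j • torusBasis i
  then h.choose else 0

/-! ### Blocks -/

/-- A finite family of blocks `Φ v × T²` over compact connected oriented smooth surfaces `Φ v` with
nonempty boundary, none of them a disk or an annulus, together with an identification of the
components of the boundary of each `Φ v` with the circle, and a pairing of all the boundary
components of all the blocks. The pairing is the graph: its vertices are the blocks, its directed
edges are the boundary components, and `rev` reverses an edge. -/
structure BlockSystem where
  /-- the blocks, i.e. the vertices of the graph -/
  V : Type
  [finV : Finite V]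
  [nonemptyV : Nonempty V]
  /-- the base surfaces -/
  Φ : V → Type
  [top : ∀ v, TopologicalSpace (Φ v)]
  [t2 : ∀ v, T2Space (Φ v)]
  [compact : ∀ v, CompactSpace (Φ v)]
  [connected : ∀ v, ConnectedSpace (Φ v)]
  [charted : ∀ v, ChartedSpace (EuclideanHalfSpace 2) (Φ v)]
  [smooth : ∀ v, IsManifold (𝓡∂ 2) ∞ (Φ v)]
  not_disk : ∀ v, IsEmpty (Φ v ≃ₜ Metric.closedBall (0 : EuclideanSpace ℝ (Fin 2)) 1)
  not_annulus : ∀ v, IsEmpty (Φ v ≃ₜ Circle × unitInterval)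
  /-- an orientation of `Φ v`, given by the positively oriented charts of an oriented atlas -/
  orientedAtlas : ∀ v, Set (OpenPartialHomeomorph (Φ v) (EuclideanHalfSpace 2))
  orientedAtlas_subset : ∀ v, orientedAtlas v ⊆ IsManifold.maximalAtlas (𝓡∂ 2) ∞ (Φ v)
  orientedAtlas_cover : ∀ v (x : Φ v), ∃ e ∈ orientedAtlas v, x ∈ e.source
  orientedAtlas_pos : ∀ v, ∀ e ∈ orientedAtlas v, ∀ e' ∈ orientedAtlas v,
    ∀ x ∈ e.source ∩ e'.source,
      0 < (fderivWithin ℝ (e'.extend (𝓡∂ 2) ∘ (e.extend (𝓡∂ 2)).symm)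
        (Set.range (𝓡∂ 2)) (e.extend (𝓡∂ 2) x)).det
  /-- the boundary components of `Φ v` -/
  bd : V → Type
  [finBd : ∀ v, Finite (bd v)]
  [nonemptyBd : ∀ v, Nonempty (bd v)]
  /-- smooth parametrizations of the boundary components -/
  circle : ∀ v, bd v → C(Circle, Φ v)
  circle_smooth : ∀ v a, ContMDiff (𝓡 1) (𝓡∂ 2) ∞ (circle v a)
  circle_injective : ∀ v, Function.Injective fun p : bd v × Circle => circle v p.1 p.2
  circle_range : ∀ v, Set.range (fun p : bd v × Circle => circle v p.1 p.2) =
    (𝓡∂ 2).boundary (Φ v)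
  /-- The parametrizations are immersions and follow the boundary orientation (outward normal
  first). In the half-plane `x₀ ≥ 0` with coordinates `(x₀, x₁)` this is the direction of
  decreasing `x₁`. -/
  circle_oriented : ∀ v a, ∀ e ∈ orientedAtlas v, ∀ θ : ℝ, circle v a (Circle.exp θ) ∈ e.source →
    deriv (fun t : ℝ => (e (circle v a (Circle.exp t))).1 1) θ < 0
  /-- reversal of directed edges -/
  rev : (Σ v, bd v) → (Σ v, bd v)
  rev_rev : ∀ w, rev (rev w) = w
  rev_ne : ∀ w, rev w ≠ w

attribute [instance] BlockSystem.finV BlockSystem.nonemptyV BlockSystem.top BlockSystem.t2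
  BlockSystem.compact BlockSystem.connected BlockSystem.charted BlockSystem.smooth
  BlockSystem.finBd BlockSystem.nonemptyBd

namespace BlockSystem

/-- Directed edges of the graph. The edge `w` issues from the vertex `w.1` and ends at the vertex
`(rev w).1`. -/
abbrev W (B : BlockSystem) : Type := Σ v, B.bd v

/-- The block `M_v`. -/
abbrev Block (B : BlockSystem) (v : B.V) : Type := B.Φ v × T2

/-- The parametrization of the boundary torus `T_w` of the block at which `w` starts. -/
def boundaryTorus (B : BlockSystem) (w : B.W) : C(T3, B.Block w.1) :=
  ⟨fun p => (B.circle w.1 w.2 p.1, p.2), by fun_prop⟩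

/-- The graph is a cycle of length `k`, with vertices `a i` and edges `e (i, true)` from `a i` to
`a (i + 1)`, of which `e (i, false)` are the reversed edges. -/
def IsCycle (B : BlockSystem) (k : ℕ) : Prop :=
  ∃ (a : ZMod k ≃ B.V) (e : ZMod k × Bool ≃ B.W), ∀ i,
    (e (i, true)).1 = a i ∧ (e (i, false)).1 = a (i + 1) ∧ B.rev (e (i, true)) = e (i, false)

/-- A trivialization of the fibration `M_v → Φ_v`: a diffeomorphism from `Φ_v × S¹ × S¹` onto the
block over the identity of `Φ_v`. -/
structure BlockTrivialization (B : BlockSystem) (v : B.V) where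
  toDiffeo : Diffeomorph ((𝓡∂ 2).prod modelT2) ((𝓡∂ 2).prod modelT2) (B.Block v) (B.Block v) ∞
  fst_eq : ∀ p, (toDiffeo p).1 = p.1

/-- The self-map of the boundary torus `T_w ≅ S¹ × T²` to which a trivialization restricts. -/
def BlockTrivialization.onTorus {B : BlockSystem} {w : B.W} (τ : B.BlockTrivialization w.1) :
    C(T3, T3) :=
  ⟨fun p => (p.1, (τ.toDiffeo (B.boundaryTorus w p)).2), by
    have := τ.toDiffeo.continuous
    fun_prop⟩

/-- The basis `(z_w, f_w¹, f_w²)` of `L_w = H₁(T_w; ℤ)` induced by a trivialization. -/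
def BlockTrivialization.basis {B : BlockSystem} {w : B.W} (τ : B.BlockTrivialization w.1)
    (j : Fin 3) : H1 T3 :=
  H1.map τ.onTorus (torusBasis j)

end BlockSystem

/-! ### Graph-manifolds -/

/-- A (presentation of a) closed oriented 4-dimensional graph-manifold with the blocks `B`:
diffeomorphisms `glue w : T_{-w} → T_w` of the boundary tori, in the coordinates given by
`B.boundaryTorus`, which reverse the orientations of the tori and do not identify the fibres. -/
structure GraphManifold (B : BlockSystem) where
  glue : B.W → Diffeomorph modelT3 modelT3 T3 T3 ∞
  glue_rev : ∀ w, glue (B.rev w) = (glue w).symm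
  glue_det : ∀ w, (homologyMatrix (glue w)).det = -1
  glue_fiber : ∀ w, fiberSubgroup.map (H1.map (T3map (glue w))) ≠ fiberSubgroup

namespace GraphManifold

variable {B : BlockSystem}

/-- The identifications of boundary points of the blocks made by the gluing. -/
inductive Glued (M : GraphManifold B) : (Σ v, B.Block v) → (Σ v, B.Block v) → Prop
  | mk (w : B.W) (p : T3) :
      Glued M ⟨(B.rev w).1, B.boundaryTorus (B.rev w) p⟩ ⟨w.1, B.boundaryTorus w (M.glue w p)⟩

/-- The underlying space of the graph-manifold, glued from the blocks. -/
def Space (M : GraphManifold B) : Type := Quot M.Glued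

instance (M : GraphManifold B) : TopologicalSpace M.Space :=
  inferInstanceAs (TopologicalSpace (Quot M.Glued))

/-- The isomorphism `ĝ_w : L_{-w} → L_w`. -/
def glueHom (M : GraphManifold B) (w : B.W) : H1 T3 →+ H1 T3 := H1.map (T3map (M.glue w))

/-- The gluing matrix `g_w`, with `(z_{-w}, f_{-w}) = (z_w, f_w) · g_w`. -/
def gluingMatrix (M : GraphManifold B) (w : B.W) : Matrix (Fin 3) (Fin 3) ℤ :=
  homologyMatrix (M.glue w)

/-- The intersection lattice `F_w ∩ ĝ_w(F_{-w})` of the edge `w`, as a subgroup of the fibre group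
`F_v = H₁(T²; ℤ)` of the vertex `v` at which `w` starts. -/
def intersectionLattice (M : GraphManifold B) (w : B.W) : AddSubgroup (H1 T2) :=
  (fiberSubgroup.map (M.glueHom w)).comap (H1.map fiberInclusion)

/-- The type of a vertex: the maximal number of pairwise non-parallel edges at the vertex, i.e. the
number of distinct intersection lattices. -/
def type (M : GraphManifold B) (v : B.V) : ℕ :=
  (Set.range fun a : B.bd v => M.intersectionLattice ⟨v, a⟩).ncard

/-- The intersection number of an edge: the greatest common divisor of the row `b_w` of the gluing
matrix. -/
def intersectionNumber (M : GraphManifold B) (w : B.W) : ℕ :=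
  Int.gcd (M.gluingMatrix w 0 1) (M.gluingMatrix w 0 2)

/-- The secondary intersection number of a vertex of type 2: the index in `F_v` of the subgroup
generated by the intersection lattices. By convention it is 1 for other vertices. -/
def secondaryIntersectionNumber (M : GraphManifold B) (v : B.V) : ℕ :=
  if M.type v = 2 then (⨆ a : B.bd v, M.intersectionLattice ⟨v, a⟩).index else 1

/-- The graph-manifold is orthogonal: for some trivializations of the blocks, the bases that they
induce on the two sides of each edge differ only by a permutation and by signs. -/
def IsOrthogonal (M : GraphManifold B) : Prop :=
  ∃ τ : ∀ v, B.BlockTrivialization v, ∀ w : B.W, ∃ (s : Equiv.Perm (Fin 3)) (ε : Fin 3 → ℤˣ),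
    ∀ j, M.glueHom w ((τ (B.rev w).1).basis (w := B.rev w) j) =
      (ε j : ℤ) • (τ w.1).basis (w := w) (s j)

end GraphManifold

/-- The torus with two holes: the flat torus `S¹ × S¹ ⊂ ℂ²` without the two disjoint open disks of
radius `√2` around the points `(1, 1)` and `(-1, -1)`. -/
def twoHoledTorus : Set (Circle × Circle) :=
  {p | 2 ≤ ‖(p.1 : ℂ) - 1‖ ^ 2 + ‖(p.2 : ℂ) - 1‖ ^ 2 ∧
    2 ≤ ‖(p.1 : ℂ) + 1‖ ^ 2 + ‖(p.2 : ℂ) + 1‖ ^ 2}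

end

noncomputable section

/-! ### Lifting to the universal cover of the circle -/

/-! The gluing along the forward edge at `i` is `(s, t, u) ↦ (t, tᵅ u, s⁻¹)` with `α = α i`. On
homology it sends `z ↦ -f²`, `f¹ ↦ z + α f¹`, `f² ↦ f¹`. The image of the fibre group is `⟨z, f¹⟩`
for every `α`. Hence each block has the two intersection lattices `⟨f¹⟩` (forward edge) and `⟨f²⟩`
(backward edge), and the type, the intersection numbers and the secondary intersection numbers do
not see `α`. For `α = 0` the matrices are signed permutations and the manifold is orthogonal.

The parameters are nevertheless detected by orthogonality. A change of trivialization acts on the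
fibre group by one matrix for the whole block, because the block is connected, and adds fibre
classes to the two `z_w`. These classes are the values of a map from the base to `T²` on the two
boundary circles, so their sum vanishes (`coord_section_add`). In orthogonal bases some fibre basis
element goes to a fibre basis element along each edge, which forces `±f¹` into the fibre basis of
every block (`exists_generator_of_edge`). At the far end of the edge, `±f¹` is sent to `±(z + α
f¹)`, which must then be `±z_w`. So `z_w` has `f¹`-coordinate `α`, while at the far end the
`f¹`-coordinate of the section is `0` (`section_of_edge`). The two `f¹`-coordinates of one block add
up to zero, so every `α i` vanishes. Taking `α` equal to `1` on one edge and `0` elsewhere gives the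
example.

Two foundations are built from scratch. The groups `H₁` of `T²` and `T³` are computed with winding
numbers, which separate the coordinate circles, and with lifts to the universal cover, which show
that these circles generate. The two-holed torus is the superlevel set `1 - (cos x₀ + cos x₁)² ≥ 0`
of a function regular on its zero set. It is the union of two annular collars meeting along `cos x₀
+ cos x₁ = 0`, which yields both its connectedness and the homology relation between its boundary
circles. -/

theorem Circle.exists_lift {A : Type*} [TopologicalSpace A] [ContractibleSpace A]
    (f : C(A, Circle)) : ∃ F : C(A, ℝ), ∀ a, Circle.exp (F a) = f a := by
  obtain ⟨a₀, ⟨H⟩⟩ := id_nullhomotopic A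
  -- The contraction is reversed so that `K` runs from a constant map, which has an evident lift, to
  -- `f`. Homotopy lifting then needs no local connectedness of `A`.
  let K : C(unitInterval × A, Circle) := f.comp H.symm.toContinuousMap
  obtain ⟨x₀, hx₀⟩ := Circle.exp_surjective (f a₀)
  have h0 : ∀ a, K (0, a) = Circle.exp (ContinuousMap.const A x₀ a) := fun a => by
    simp [K, hx₀]
  refine ⟨(Circle.isCoveringMap_exp.liftHomotopy K (.const A x₀) h0).comp
    ⟨fun a => (1, a), by fun_prop⟩, fun a => ?_⟩
  have := congrFun (Circle.isCoveringMap_exp.liftHomotopy_lifts K (.const A x₀) h0) (1, a)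
  simpa [K] using this

/-- Uniqueness of lifts: two lifts of one map on a preconnected space differ by a constant. This is
what makes turning numbers well defined and comparable along families. -/
theorem Circle.lift_sub_eq {A : Type*} [TopologicalSpace A] [PreconnectedSpace A] {F G : A → ℝ}
    (hF : Continuous F) (hG : Continuous G) (h : ∀ a, Circle.exp (F a) = Circle.exp (G a))
    (a b : A) : F a - F b = G a - G b := by
  have h1 : Circle.exp (F b - G b) = 1 := by rw [Circle.exp_sub, h b, div_self']
  have := Circle.isCoveringMap_exp.eq_of_comp_eq hF (g₂ := fun x => G x + (F b - G b))
    (by fun_prop) (by ext x; simp [Circle.exp_add, h1, h x]) b (by simp)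
  have := congrFun this a
  linarith

instance (n : ℕ) : ContractibleSpace (stdSimplex ℝ (Fin (n + 1))) :=
  (convex_stdSimplex ℝ _).contractibleSpace ⟨_, single_mem_stdSimplex ℝ 0⟩

/-- The `i`-th vertex of the standard simplex. -/
abbrev vtx (n : ℕ) (i : Fin (n + 1)) : stdSimplex ℝ (Fin (n + 1)) := stdSimplex.vertex i

theorem simplexFace_vtx (n : ℕ) (i : Fin (n + 2)) (j : Fin (n + 1)) :
    simplexFace n i (vtx n j) = vtx (n + 1) (i.succAbove j) :=
  stdSimplex.map_vertex _ _

/-! ### Winding numbers of homology classes -/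

/-- The total turning of a path in the circle, in units of full turns. -/
def turning (σ : C(stdSimplex ℝ (Fin 2), Circle)) : ℝ :=
  ((Circle.exists_lift σ).choose (vtx 1 1) - (Circle.exists_lift σ).choose (vtx 1 0)) /
    (2 * Real.pi)

theorem turning_eq {σ : C(stdSimplex ℝ (Fin 2), Circle)} {F : stdSimplex ℝ (Fin 2) → ℝ}
    (hF : Continuous F) (h : ∀ t, Circle.exp (F t) = σ t) :
    turning σ = (F (vtx 1 1) - F (vtx 1 0)) / (2 * Real.pi) := by
  rw [turning, Circle.lift_sub_eq (ContinuousMap.continuous _) hF fun t => ?_]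
  rw [h, (Circle.exists_lift σ).choose_spec]

/-- The turning homomorphism on singular chains. -/
def chainTurning {X : Type} [TopologicalSpace X] (f : C(X, Circle)) : SingularChain 1 X →+ ℝ :=
  FreeAbelianGroup.lift fun σ => turning (f.comp σ)

theorem singularBoundary_of {X : Type} [TopologicalSpace X] (T : C(stdSimplex ℝ (Fin 3), X)) :
    singularBoundary 1 X (FreeAbelianGroup.of T) =
      FreeAbelianGroup.of (T.comp (simplexFace 1 0)) -
        FreeAbelianGroup.of (T.comp (simplexFace 1 1)) +
        FreeAbelianGroup.of (T.comp (simplexFace 1 2)) := by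
  rw [singularBoundary, FreeAbelianGroup.lift_apply_of]
  refine (Fin.sum_univ_three _).trans ?_
  simp [sub_eq_add_neg]

/-- One lift over the whole triangle computes the turning of all three faces, and the differences of
its values at the vertices cancel. -/
theorem chainTurning_boundary {X : Type} [TopologicalSpace X] (f : C(X, Circle))
    (c : SingularChain 2 X) : chainTurning f (singularBoundary 1 X c) = 0 := by
  have h : (chainTurning f).comp (singularBoundary 1 X) = 0 := by
    apply FreeAbelianGroup.lift_ext
    intro σ
    obtain ⟨F, hF⟩ := Circle.exists_lift (f.comp σ)
    have hi (i : Fin 3) : turning (f.comp (σ.comp (simplexFace 1 i))) =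
        (F (vtx 2 (i.succAbove 1)) - F (vtx 2 (i.succAbove 0))) / (2 * Real.pi) := by
      rw [turning_eq (F := F ∘ simplexFace 1 i) (by fun_prop) (fun t => hF _)]
      simp only [Function.comp_apply, simplexFace_vtx]
    have hs : chainTurning f (singularBoundary 1 X (FreeAbelianGroup.of σ)) =
        turning (f.comp (σ.comp (simplexFace 1 0))) - turning (f.comp (σ.comp (simplexFace 1 1))) +
          turning (f.comp (σ.comp (simplexFace 1 2))) := by
      rw [singularBoundary_of, map_add, map_sub]
      simp only [chainTurning, FreeAbelianGroup.lift_apply_of]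
    rw [AddMonoidHom.comp_apply, hs, hi, hi, hi]
    have e : (Fin.succAbove (0 : Fin 3) (1 : Fin 2), Fin.succAbove (0 : Fin 3) (0 : Fin 2),
      Fin.succAbove (1 : Fin 3) (1 : Fin 2), Fin.succAbove (1 : Fin 3) (0 : Fin 2),
      Fin.succAbove (2 : Fin 3) (1 : Fin 2), Fin.succAbove (2 : Fin 3) (0 : Fin 2)) =
      (2, 1, 2, 0, 1, 0) := by decide
    simp only [Prod.mk.injEq] at e
    obtain ⟨e1, e2, e3, e4, e5, e6⟩ := e
    rw [e1, e2, e3, e4, e5, e6, AddMonoidHom.zero_apply]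
    ring
  exact DFunLike.congr_fun h c

/-- The pairing of `H₁(X)` with the class in `H¹(X)` of a map to the circle. -/
def winding {X : Type} [TopologicalSpace X] (f : C(X, Circle)) : H1 X →+ ℝ :=
  QuotientAddGroup.lift _ ((chainTurning f).comp (SingularCycle X).subtype) (by
    rintro ⟨c, hc⟩ ⟨b, rfl⟩
    exact chainTurning_boundary f b)

theorem winding_map {X Y : Type} [TopologicalSpace X] [TopologicalSpace Y] (f : C(Y, Circle))
    (g : C(X, Y)) (x : H1 X) : winding f (H1.map g x) = winding (f.comp g) x := by
  have h : (chainTurning f).comp (singularChainMap 1 g) = chainTurning (f.comp g) := by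
    apply FreeAbelianGroup.lift_ext
    intro σ
    simp [singularChainMap, chainTurning, ContinuousMap.comp_assoc]
  obtain ⟨c, rfl⟩ := QuotientAddGroup.mk_surjective x
  exact DFunLike.congr_fun h c.1

/-- The sum of lifts is a lift of the product. Together with `winding_map` this reads off the action
on homology of maps whose components are monomials. -/
theorem winding_mul {X : Type} [TopologicalSpace X] (f g : C(X, Circle)) (x : H1 X) :
    winding (f * g) x = winding f x + winding g x := by
  have h : chainTurning (f * g) = chainTurning f + chainTurning g := by
    apply FreeAbelianGroup.lift_ext
    intro σ
    obtain ⟨F, hF⟩ := Circle.exists_lift (f.comp σ)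
    obtain ⟨G, hG⟩ := Circle.exists_lift (g.comp σ)
    simp only [chainTurning, FreeAbelianGroup.lift_apply_of, AddMonoidHom.add_apply]
    rw [turning_eq F.continuous hF, turning_eq G.continuous hG,
      turning_eq (F := F + G) (by fun_prop) (fun t => by
        simp only [Pi.add_apply, Circle.exp_add, hF, hG]; rfl)]
    simp only [Pi.add_apply]
    ring
  obtain ⟨c, rfl⟩ := QuotientAddGroup.mk_surjective x
  exact DFunLike.congr_fun h c.1

theorem winding_one {X : Type} [TopologicalSpace X] (x : H1 X) :
    winding (1 : C(X, Circle)) x = 0 := by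
  have := winding_mul 1 1 x
  rw [mul_one] at this
  linarith

theorem winding_inv {X : Type} [TopologicalSpace X] (f : C(X, Circle)) (x : H1 X) :
    winding f⁻¹ x = -winding f x := by
  have := winding_mul f f⁻¹ x
  rw [mul_inv_cancel, winding_one] at this
  linarith

theorem loopSimplex_eq_exp {X : Type} [TopologicalSpace X] (γ : C(Circle, X))
    (t : stdSimplex ℝ (Fin 2)) : loopSimplex γ t = γ (Circle.exp (2 * Real.pi * t.1 1)) := rfl

/-- The winding number of a loop, computed by a lift of the loop. -/
theorem winding_loopClass {X : Type} [TopologicalSpace X] (f : C(X, Circle)) (γ : C(Circle, X))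
    {F : ℝ → ℝ} (hF : Continuous F) (h : ∀ t, Circle.exp (F t) = f (γ (Circle.exp t))) :
    winding f (loopClass γ) = (F (2 * Real.pi) - F 0) / (2 * Real.pi) := by
  have : winding f (loopClass γ) = turning (f.comp (loopSimplex γ)) := by
    exact FreeAbelianGroup.lift_apply_of _ _
  rw [this, turning_eq (F := fun t => F (2 * Real.pi * t.1 1))
    (hF.comp (continuous_const.mul ((continuous_apply 1).comp continuous_subtype_val)))
    fun t => h _]
  simp

theorem H1.map_loopClass {X Y : Type} [TopologicalSpace X] [TopologicalSpace Y] (f : C(X, Y))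
    (γ : C(Circle, X)) : H1.map f (loopClass γ) = loopClass (f.comp γ) := by
  change QuotientAddGroup.mk _ = QuotientAddGroup.mk _
  congr 1

theorem H1.map_comp {X Y Z : Type} [TopologicalSpace X] [TopologicalSpace Y] [TopologicalSpace Z]
    (f : C(Y, Z)) (g : C(X, Y)) (x : H1 X) : H1.map (f.comp g) x = H1.map f (H1.map g x) := by
  have h : singularChainMap 1 (f.comp g) =
      (singularChainMap 1 f).comp (singularChainMap 1 g) := by
    apply FreeAbelianGroup.lift_ext
    intro σ
    simp [singularChainMap, ContinuousMap.comp_assoc]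
  obtain ⟨c, rfl⟩ := QuotientAddGroup.mk_surjective x
  change QuotientAddGroup.mk _ = QuotientAddGroup.mk _
  congr 1
  apply Subtype.ext
  exact DFunLike.congr_fun h c.1

theorem H1.map_id {X : Type} [TopologicalSpace X] (x : H1 X) :
    H1.map (ContinuousMap.id X) x = x := by
  have h : singularChainMap 1 (ContinuousMap.id X) = AddMonoidHom.id _ := by
    apply FreeAbelianGroup.lift_ext
    intro σ
    simp [singularChainMap]
  obtain ⟨c, rfl⟩ := QuotientAddGroup.mk_surjective x
  change QuotientAddGroup.mk _ = QuotientAddGroup.mk _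
  congr 1
  apply Subtype.ext
  exact DFunLike.congr_fun h c.1

/-! ### Generation of the first homology of a quotient of a vector space by a lattice -/

/-- Singular `1`-chains modulo boundaries. -/
abbrev ChainMod (X : Type) [TopologicalSpace X] : Type :=
  SingularChain 1 X ⧸ (singularBoundary 1 X).range

/-- The class of a singular `1`-simplex modulo boundaries. -/
def simplexClass {X : Type} [TopologicalSpace X] (σ : C(stdSimplex ℝ (Fin 2), X)) : ChainMod X :=
  QuotientAddGroup.mk (FreeAbelianGroup.of σ)

/-- The boundary relation solved for the middle face; it is the only relation between singular
simplices used below. -/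
theorem simplexClass_triangle {X : Type} [TopologicalSpace X] (T : C(stdSimplex ℝ (Fin 3), X)) :
    simplexClass (T.comp (simplexFace 1 1)) =
      simplexClass (T.comp (simplexFace 1 2)) + simplexClass (T.comp (simplexFace 1 0)) := by
  have h : (QuotientAddGroup.mk (singularBoundary 1 X (FreeAbelianGroup.of T)) : ChainMod X) = 0 :=
    (QuotientAddGroup.eq_zero_iff _).2 ⟨_, rfl⟩
  rw [singularBoundary_of] at h
  change simplexClass _ - simplexClass _ + simplexClass _ = 0 at h
  rw [← sub_eq_zero, ← neg_eq_zero, ← h]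
  abel

theorem simplexFace_apply (i : Fin 3) (t : stdSimplex ℝ (Fin 2)) (j : Fin 2) :
    (simplexFace 1 i t).1 (i.succAbove j) = t.1 j := by
  change ((FunOnFinite.linearMap ℝ ℝ (Fin.succAbove i)) t.1) _ = _
  rw [FunOnFinite.linearMap_apply_apply]
  rw [Finset.sum_eq_single j] <;> simp

theorem simplexFace_apply_self (i : Fin 3) (t : stdSimplex ℝ (Fin 2)) :
    (simplexFace 1 i t).1 i = 0 := by
  change ((FunOnFinite.linearMap ℝ ℝ (Fin.succAbove i)) t.1) _ = _
  rw [FunOnFinite.linearMap_apply_apply]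
  simp

/-- All faces of a constant triangle are the same constant simplex `c`, so `c = c + c`. -/
theorem simplexClass_const {X : Type} [TopologicalSpace X] (x : X) :
    simplexClass (ContinuousMap.const _ x) = 0 := by
  have := simplexClass_triangle (ContinuousMap.const _ x)
  simpa using this

section Lattice

variable {E : Type} [NormedAddCommGroup E] [NormedSpace ℝ E] {G : Type} [TopologicalSpace G]

/-- The straight path from `a` to `b`. -/
def segmentSimplex (a b : E) : C(stdSimplex ℝ (Fin 2), E) :=
  ⟨fun t => t.1 0 • a + t.1 1 • b, by
    have h (i : Fin 2) : Continuous fun t : stdSimplex ℝ (Fin 2) => t.1 i :=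
      (continuous_apply i).comp continuous_subtype_val
    exact ((h 0).smul continuous_const).add ((h 1).smul continuous_const)⟩

/-- The class of the image of a straight path. -/
def segmentClass (p : C(E, G)) (a b : E) : ChainMod G := simplexClass (p.comp (segmentSimplex a b))

theorem segmentClass_add (p : C(E, G)) (a b c : E) :
    segmentClass p a b + segmentClass p b c = segmentClass p a c := by
  have h (i : Fin 3) : Continuous fun t : stdSimplex ℝ (Fin 3) => t.1 i :=
    (continuous_apply i).comp continuous_subtype_val
  let T : C(stdSimplex ℝ (Fin 3), E) := ⟨fun t => t.1 0 • a + t.1 1 • b + t.1 2 • c, by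
    exact (((h 0).smul continuous_const).add ((h 1).smul continuous_const)).add
      ((h 2).smul continuous_const)⟩
  have key := simplexClass_triangle (p.comp T)
  have h0 : T.comp (simplexFace 1 0) = segmentSimplex b c := by
    ext t
    have e0 := simplexFace_apply_self 0 t
    have e1 : (simplexFace 1 0 t).1 1 = t.1 0 := simplexFace_apply 0 t 0
    have e2 : (simplexFace 1 0 t).1 2 = t.1 1 := simplexFace_apply 0 t 1
    simp only [T, segmentSimplex, ContinuousMap.comp_apply, ContinuousMap.coe_mk, e0, e1, e2]
    simp
  have h1 : T.comp (simplexFace 1 1) = segmentSimplex a c := by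
    ext t
    have e0 := simplexFace_apply_self 1 t
    have e1 : (simplexFace 1 1 t).1 0 = t.1 0 := simplexFace_apply 1 t 0
    have e2 : (simplexFace 1 1 t).1 2 = t.1 1 := simplexFace_apply 1 t 1
    simp only [T, segmentSimplex, ContinuousMap.comp_apply, ContinuousMap.coe_mk, e0, e1, e2]
    simp
  have h2 : T.comp (simplexFace 1 2) = segmentSimplex a b := by
    ext t
    have e0 := simplexFace_apply_self 2 t
    have e1 : (simplexFace 1 2 t).1 0 = t.1 0 := simplexFace_apply 2 t 0
    have e2 : (simplexFace 1 2 t).1 1 = t.1 1 := simplexFace_apply 2 t 1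
    simp only [T, segmentSimplex, ContinuousMap.comp_apply, ContinuousMap.coe_mk, e0, e1, e2]
    simp
  rw [ContinuousMap.comp_assoc, ContinuousMap.comp_assoc, ContinuousMap.comp_assoc, h0, h1, h2]
    at key
  exact key.symm

theorem segmentClass_self (p : C(E, G)) (a : E) : segmentClass p a a = 0 := by
  have := segmentClass_add p a a a
  simpa using this

/-- A path in a vector space is homologous to the straight path with the same ends. -/
theorem simplexClass_comp (p : C(E, G)) (g : C(stdSimplex ℝ (Fin 2), E)) :
    simplexClass (p.comp g) = segmentClass p (g (vtx 1 0)) (g (vtx 1 1)) := by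
  set L := segmentSimplex (g (vtx 1 0)) (g (vtx 1 1)) with hL
  have hL0 : L (vtx 1 0) = g (vtx 1 0) := by simp [hL, segmentSimplex]
  have hL1 : L (vtx 1 1) = g (vtx 1 1) := by simp [hL, segmentSimplex]
  have h (i : Fin 3) : Continuous fun t : stdSimplex ℝ (Fin 3) => t.1 i :=
    (continuous_apply i).comp continuous_subtype_val
  have hm (φ : Fin 3 → Fin 2) :
      Continuous fun t : stdSimplex ℝ (Fin 3) => (stdSimplex.map φ t : stdSimplex ℝ (Fin 2)) :=
    stdSimplex.continuous_map φ
  -- `A` and `B` are the two triangles of the square of the straight homotopy from `g` to `L`. They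
  -- share the diagonal, the face opposite to vertex 1. The other faces of `A` are `g` and a
  -- constant path, those of `B` are `L` and a constant path.
  let A : C(stdSimplex ℝ (Fin 3), E) :=
    ⟨fun t => (1 - t.1 2) • g (stdSimplex.map ![0, 1, 1] t) +
        t.1 2 • L (stdSimplex.map ![0, 1, 1] t),
      ((continuous_const.sub (h 2)).smul (g.continuous.comp (hm _))).add
        ((h 2).smul (L.continuous.comp (hm _)))⟩
  let B : C(stdSimplex ℝ (Fin 3), E) :=
    ⟨fun t => t.1 0 • g (stdSimplex.map ![0, 0, 1] t) +
        (1 - t.1 0) • L (stdSimplex.map ![0, 0, 1] t),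
      ((h 0).smul (g.continuous.comp (hm _))).add
        ((continuous_const.sub (h 0)).smul (L.continuous.comp (hm _)))⟩
  have hface (φ : Fin 3 → Fin 2) (i : Fin 3) (t : stdSimplex ℝ (Fin 2)) :
      (stdSimplex.map φ (simplexFace 1 i t) : stdSimplex ℝ (Fin 2)) =
        stdSimplex.map (φ ∘ i.succAbove) t := stdSimplex.map_comp_apply _ _ _
  have hc (c : Fin 2) (t : stdSimplex ℝ (Fin 2)) :
      (stdSimplex.map (fun _ : Fin 2 => c) t : stdSimplex ℝ (Fin 2)) = vtx 1 c := by
    apply Subtype.ext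
    funext j
    change ((FunOnFinite.linearMap ℝ ℝ (fun _ : Fin 2 => c)) t.1) j = _
    rw [FunOnFinite.linearMap_apply_apply]
    have ht : t.1 0 + t.1 1 = 1 := by simpa using t.2.2
    by_cases hj : c = j
    · subst hj
      simp [ht]
    · simp [hj, Ne.symm hj]
  have c1 : (![0, 1, 1] : Fin 3 → Fin 2) ∘ Fin.succAbove 0 = fun _ => 1 := by decide
  have c2 : (![0, 1, 1] : Fin 3 → Fin 2) ∘ Fin.succAbove 1 = id := by decide
  have c3 : (![0, 1, 1] : Fin 3 → Fin 2) ∘ Fin.succAbove 2 = id := by decide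
  have d1 : (![0, 0, 1] : Fin 3 → Fin 2) ∘ Fin.succAbove 0 = id := by decide
  have d2 : (![0, 0, 1] : Fin 3 → Fin 2) ∘ Fin.succAbove 1 = id := by decide
  have d3 : (![0, 0, 1] : Fin 3 → Fin 2) ∘ Fin.succAbove 2 = fun _ => 0 := by decide
  have A0 : A.comp (simplexFace 1 0) = ContinuousMap.const _ (g (vtx 1 1)) := by
    ext t
    simp only [A, ContinuousMap.comp_apply, ContinuousMap.coe_mk, hface, c1, hc, hL1,
      ContinuousMap.const_apply, ← add_smul]
    simp
  have A2 : A.comp (simplexFace 1 2) = g := by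
    ext t
    simp only [A, ContinuousMap.comp_apply, ContinuousMap.coe_mk, hface, c3,
      stdSimplex.map_id_apply, simplexFace_apply_self]
    simp
  have B0 : B.comp (simplexFace 1 0) = L := by
    ext t
    simp only [B, ContinuousMap.comp_apply, ContinuousMap.coe_mk, hface, d1,
      stdSimplex.map_id_apply, simplexFace_apply_self]
    simp
  have B2 : B.comp (simplexFace 1 2) = ContinuousMap.const _ (g (vtx 1 0)) := by
    ext t
    simp only [B, ContinuousMap.comp_apply, ContinuousMap.coe_mk, hface, d3, hc, hL0,
      ContinuousMap.const_apply, ← add_smul]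
    simp
  have AB : A.comp (simplexFace 1 1) = B.comp (simplexFace 1 1) := by
    ext t
    have e1 : (simplexFace 1 1 t).1 0 = t.1 0 := simplexFace_apply 1 t 0
    have e2 : (simplexFace 1 1 t).1 2 = t.1 1 := simplexFace_apply 1 t 1
    have ht : t.1 0 + t.1 1 = 1 := by simpa using t.2.2
    simp only [A, B, ContinuousMap.comp_apply, ContinuousMap.coe_mk, hface, c2, d2,
      stdSimplex.map_id_apply, e1, e2, ← eq_sub_iff_add_eq.2 ht, ← eq_sub_iff_add_eq'.2 ht]
  have kA := simplexClass_triangle (p.comp A)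
  have kB := simplexClass_triangle (p.comp B)
  have hconst (x : E) : simplexClass (p.comp (ContinuousMap.const (stdSimplex ℝ (Fin 2)) x)) = 0 :=
    simplexClass_const (p x)
  rw [ContinuousMap.comp_assoc, ContinuousMap.comp_assoc, ContinuousMap.comp_assoc] at kA kB
  rw [A0, A2, hconst, add_zero, AB, kB, B0, B2, hconst, zero_add] at kA
  exact kA.symm

variable (p : C(E, G)) (Λ : AddSubgroup E)

theorem segmentClass_translate (hp : ∀ x, ∀ m ∈ Λ, p (x + m) = p x) (a b : E) {m : E}
    (hm : m ∈ Λ) : segmentClass p (a + m) (b + m) = segmentClass p a b := by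
  unfold segmentClass
  congr 1
  ext t
  have ht : t.1 0 + t.1 1 = 1 := by simpa using t.2.2
  have : t.1 0 • (a + m) + t.1 1 • (b + m) = (t.1 0 • a + t.1 1 • b) + m := by
    rw [smul_add, smul_add, add_add_add_comm, ← add_smul, ht, one_smul]
  change p (t.1 0 • (a + m) + t.1 1 • (b + m)) = p (t.1 0 • a + t.1 1 • b)
  rw [this, hp _ _ hm]

/-- Translating the second segment by the period `m` puts it after the first, so `m ↦ segmentClass p
0 m` is additive on `Λ`. -/
theorem segmentClass_lattice_add (hp : ∀ x, ∀ m ∈ Λ, p (x + m) = p x) {m m' : E}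
    (hm : m ∈ Λ) : segmentClass p 0 (m + m') = segmentClass p 0 m + segmentClass p 0 m' := by
  have h := segmentClass_translate p Λ hp 0 m' hm
  rw [zero_add] at h
  rw [← segmentClass_add p 0 m, add_comm m m', h]

/-- Every `1`-cycle of `E / Λ` is homologous to the straight loop of an element of `Λ`. -/
theorem exists_lattice_class (hp : ∀ x, ∀ m ∈ Λ, p (x + m) = p x)
    (hp' : ∀ x y, p x = p y → y - x ∈ Λ)
    (hl : ∀ σ : C(stdSimplex ℝ (Fin 2), G), ∃ τ : C(stdSimplex ℝ (Fin 2), E), p.comp τ = σ)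
    (c : SingularChain 1 G) (hc : c ∈ SingularCycle G) :
    ∃ m ∈ Λ, (QuotientAddGroup.mk c : ChainMod G) = segmentClass p 0 m := by
  have hs : ∀ x : G, ∃ y : E, p y = x := fun x => by
    obtain ⟨τ, hτ⟩ := hl (ContinuousMap.const _ x)
    exact ⟨τ (vtx 1 0), DFunLike.congr_fun hτ (vtx 1 0)⟩
  choose s hs using hs
  -- Coning from the origin: each point of `G` is joined to `p 0` by the segment to its chosen lift.
  let h : SingularChain 0 G →+ ChainMod G :=
    FreeAbelianGroup.lift fun τ => segmentClass p 0 (s (τ (vtx 0 0)))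
  have hbd (σ : C(stdSimplex ℝ (Fin 2), G)) : h (singularBoundary 0 G (FreeAbelianGroup.of σ)) =
      segmentClass p 0 (s (σ (vtx 1 1))) - segmentClass p 0 (s (σ (vtx 1 0))) := by
    have : singularBoundary 0 G (FreeAbelianGroup.of σ) =
        FreeAbelianGroup.of (σ.comp (simplexFace 0 0)) -
          FreeAbelianGroup.of (σ.comp (simplexFace 0 1)) := by
      rw [singularBoundary, FreeAbelianGroup.lift_apply_of]
      refine (Fin.sum_univ_two _).trans ?_
      simp [sub_eq_add_neg]
    rw [this, map_sub]
    simp only [h, FreeAbelianGroup.lift_apply_of, ContinuousMap.comp_apply, simplexFace_vtx]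
    rfl
  -- An arbitrary chain is a lattice loop plus the cone on its boundary, a statement that can be
  -- proved simplex by simplex; for a cycle the cone vanishes.
  have key (c : SingularChain 1 G) : ∃ m ∈ Λ, (QuotientAddGroup.mk c : ChainMod G) =
      segmentClass p 0 m + h (singularBoundary 0 G c) := by
    induction c using FreeAbelianGroup.induction_on' with
    | zero => exact ⟨0, Λ.zero_mem, by simp [segmentClass_self]⟩
    | pure σ =>
      change ∃ m ∈ Λ, (QuotientAddGroup.mk (FreeAbelianGroup.of σ) : ChainMod G) =
        segmentClass p 0 m + h (singularBoundary 0 G (FreeAbelianGroup.of σ))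
      obtain ⟨τ, hτ⟩ := hl σ
      have hσ (i : Fin 2) : p (τ (vtx 1 i)) = σ (vtx 1 i) := DFunLike.congr_fun hτ _
      have h0 := hp' _ _ ((hs _).trans (hσ 0).symm)
      have h1 := hp' _ _ ((hs _).trans (hσ 1).symm)
      set a := s (σ (vtx 1 0))
      set b := s (σ (vtx 1 1))
      set m₀ := τ (vtx 1 0) - a
      set m₁ := τ (vtx 1 1) - b
      refine ⟨m₁ - m₀, Λ.sub_mem h1 h0, ?_⟩
      have e : (QuotientAddGroup.mk (FreeAbelianGroup.of σ) : ChainMod G) =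
        segmentClass p (τ (vtx 1 0)) (τ (vtx 1 1)) := by
        rw [← simplexClass_comp, hτ]
        rfl
      have e0 : τ (vtx 1 0) = a + m₀ := by simp [m₀]
      -- Translated by `-m₀`, the lifted path runs from `a` to `b + (m₁ - m₀)`. It decomposes into
      -- `-[0, a]`, the lattice segment `[0, m₁ - m₀]` and a translate of `[0, b]`.
      have e1 : τ (vtx 1 1) = (b + (m₁ - m₀)) + m₀ := by
        simp only [m₁]
        abel
      rw [e, e0, e1, segmentClass_translate p Λ hp _ _ h0, hbd,
        ← segmentClass_add p a 0, ← segmentClass_add p 0 (m₁ - m₀)]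
      have e2 := segmentClass_translate p Λ hp 0 b (Λ.sub_mem h1 h0)
      have e3 := segmentClass_add p a 0 a
      rw [segmentClass_self] at e3
      rw [zero_add] at e2
      rw [e2, eq_neg_of_add_eq_zero_left e3]
      abel
    | neg σ ih =>
      obtain ⟨m, hm, e⟩ := ih
      refine ⟨-m, Λ.neg_mem hm, ?_⟩
      have e1 := segmentClass_lattice_add p Λ hp (m' := -m) hm
      rw [add_neg_cancel, segmentClass_self] at e1
      rw [QuotientAddGroup.mk_neg, e, map_neg, map_neg, neg_add,
        eq_neg_of_add_eq_zero_right e1.symm]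
    | add x y hx hy =>
      obtain ⟨m, hm, e⟩ := hx
      obtain ⟨m', hm', e'⟩ := hy
      refine ⟨m + m', Λ.add_mem hm hm', ?_⟩
      rw [QuotientAddGroup.mk_add, e, e', map_add, map_add, segmentClass_lattice_add p Λ hp hm]
      abel
  obtain ⟨m, hm, e⟩ := key c
  have hc' : singularBoundary 0 G c = 0 := hc
  exact ⟨m, hm, by rw [e, hc', map_zero, add_zero]⟩

end Lattice

/-- The comparison of homology classes with chains modulo boundaries. -/
def H1.toChainMod (X : Type) [TopologicalSpace X] : H1 X →+ ChainMod X :=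
  QuotientAddGroup.map _ _ (SingularCycle X).subtype fun _ h => h

theorem H1.toChainMod_injective (X : Type) [TopologicalSpace X] :
    Function.Injective (H1.toChainMod X) := by
  rw [injective_iff_map_eq_zero]
  intro x hx
  obtain ⟨c, rfl⟩ := QuotientAddGroup.mk_surjective x
  have hc : (QuotientAddGroup.mk c.1 : ChainMod X) = 0 := hx
  rw [QuotientAddGroup.eq_zero_iff] at hc ⊢
  exact hc

/-! ### The first homology of tori -/

/-- A cycle is homologous to the straight loop of some `m ∈ Λ`, and additivity expands it in the
straight loops of the generators `v i`, which are the `γ i`. -/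
theorem exists_sum_loopClass {E : Type} [NormedAddCommGroup E] [NormedSpace ℝ E] {G : Type}
    [TopologicalSpace G] (p : C(E, G)) (Λ : AddSubgroup E)
    (hp : ∀ x, ∀ m ∈ Λ, p (x + m) = p x) (hp' : ∀ x y, p x = p y → y - x ∈ Λ)
    (hl : ∀ σ : C(stdSimplex ℝ (Fin 2), G), ∃ τ : C(stdSimplex ℝ (Fin 2), E), p.comp τ = σ)
    {ι : Type} [Fintype ι] (v : ι → E) (hv : ∀ i, v i ∈ Λ)
    (hΛ : ∀ m ∈ Λ, ∃ n : ι → ℤ, m = ∑ i, n i • v i) (γ : ι → C(Circle, G))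
    (hγ : ∀ i (t : ℝ), γ i (Circle.exp (2 * Real.pi * t)) = p (t • v i)) (x : H1 G) :
    ∃ n : ι → ℤ, x = ∑ i, n i • loopClass (γ i) := by
  let φ : Λ →+ ChainMod G :=
    AddMonoidHom.mk' (fun m => segmentClass p 0 m.1) fun a b =>
      segmentClass_lattice_add p Λ hp a.2
  obtain ⟨c, rfl⟩ := QuotientAddGroup.mk_surjective x
  obtain ⟨m, hm, e⟩ := exists_lattice_class p Λ hp hp' hl c.1 c.2
  obtain ⟨n, hn⟩ := hΛ m hm
  refine ⟨n, H1.toChainMod_injective G ?_⟩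
  have hi (i : ι) : H1.toChainMod G (loopClass (γ i)) = φ ⟨v i, hv i⟩ := by
    change simplexClass _ = simplexClass _
    congr 1
    ext t
    rw [loopSimplex_eq_exp, hγ]
    simp [segmentSimplex]
  have hm' : (⟨m, hm⟩ : Λ) = ∑ i, n i • ⟨v i, hv i⟩ := by
    apply Subtype.ext
    simp [hn]
  calc H1.toChainMod G (QuotientAddGroup.mk c) = φ ⟨m, hm⟩ := e
    _ = _ := by rw [hm', map_sum, map_sum]; simp only [map_zsmul, hi]

theorem exists_int_of_exp_eq {x y : ℝ} (h : Circle.exp x = Circle.exp y) :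
    ∃ n : ℤ, y - x = n * (2 * Real.pi) := by
  have : Circle.exp (y - x) = 1 := by rw [Circle.exp_sub, h, div_self']
  exact Circle.exp_eq_one.1 this

/-- The coordinate circles of the fibre torus. -/
def fiberCircle : Fin 2 → C(Circle, T2)
  | 0 => ⟨fun s => (s, 1), by fun_prop⟩
  | 1 => ⟨fun s => (1, s), by fun_prop⟩

/-- The standard basis of `H₁(T²; ℤ)`. -/
def fiberBasis (j : Fin 2) : H1 T2 := loopClass (fiberCircle j)

theorem exists_fiberBasis_sum (x : H1 T2) : ∃ n : Fin 2 → ℤ, x = ∑ i, n i • fiberBasis i := by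
  let p : C(ℝ × ℝ, T2) := ⟨fun x => (Circle.exp x.1, Circle.exp x.2), by fun_prop⟩
  let Λ : AddSubgroup (ℝ × ℝ) :=
    { carrier := {m | Circle.exp m.1 = 1 ∧ Circle.exp m.2 = 1}
      zero_mem' := by simp
      add_mem' := by
        rintro a b ⟨h1, h2⟩ ⟨h3, h4⟩
        simp [Circle.exp_add, *]
      neg_mem' := by
        rintro a ⟨h1, h2⟩
        simp [Circle.exp_neg, *] }
  refine exists_sum_loopClass p Λ ?_ ?_ ?_
    (fun i => match i with | 0 => (2 * Real.pi, 0) | 1 => (0, 2 * Real.pi)) ?_ ?_ fiberCircle ?_ x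
  · rintro x m ⟨h1, h2⟩
    simp [p, Circle.exp_add, *]
  · rintro x y h
    have h1 := congrArg Prod.fst h
    have h2 := congrArg Prod.snd h
    simp only [p, ContinuousMap.coe_mk] at h1 h2
    exact ⟨by simp [Circle.exp_sub, h1], by simp [Circle.exp_sub, h2]⟩
  · intro σ
    obtain ⟨F, hF⟩ := Circle.exists_lift ((ContinuousMap.fst).comp σ)
    obtain ⟨G, hG⟩ := Circle.exists_lift ((ContinuousMap.snd).comp σ)
    refine ⟨F.prodMk G, ?_⟩
    ext1 t
    exact Prod.ext (hF t) (hG t)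
  · intro i
    fin_cases i <;> exact ⟨by simp, by simp⟩
  · rintro ⟨a, b⟩ ⟨h1, h2⟩
    obtain ⟨m, rfl⟩ := Circle.exp_eq_one.1 h1
    obtain ⟨n, rfl⟩ := Circle.exp_eq_one.1 h2
    exact ⟨![m, n], by ext <;> simp⟩
  · intro i t
    fin_cases i <;> simp [p, fiberCircle, mul_comm]

theorem exists_torusBasis_sum (x : H1 T3) : ∃ n : Fin 3 → ℤ, x = ∑ i, n i • torusBasis i := by
  let p : C(ℝ × ℝ × ℝ, T3) :=
    ⟨fun x => (Circle.exp x.1, (Circle.exp x.2.1, Circle.exp x.2.2)), by fun_prop⟩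
  let Λ : AddSubgroup (ℝ × ℝ × ℝ) :=
    { carrier := {m | Circle.exp m.1 = 1 ∧ Circle.exp m.2.1 = 1 ∧ Circle.exp m.2.2 = 1}
      zero_mem' := by simp
      add_mem' := by
        rintro a b ⟨h1, h2, h3⟩ ⟨h4, h5, h6⟩
        simp [Circle.exp_add, *]
      neg_mem' := by
        rintro a ⟨h1, h2, h3⟩
        simp [Circle.exp_neg, *] }
  refine exists_sum_loopClass p Λ ?_ ?_ ?_
    (fun i => match i with
      | 0 => (2 * Real.pi, 0, 0) | 1 => (0, 2 * Real.pi, 0) | 2 => (0, 0, 2 * Real.pi))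
    ?_ ?_ coordinateCircle ?_ x
  · rintro x m ⟨h1, h2, h3⟩
    simp [p, Circle.exp_add, *]
  · rintro x y h
    have h1 := congrArg Prod.fst h
    have h2 := congrArg (fun z => z.2.1) h
    have h3 := congrArg (fun z => z.2.2) h
    simp only [p, ContinuousMap.coe_mk] at h1 h2 h3
    exact ⟨by simp [Circle.exp_sub, h1], by simp [Circle.exp_sub, h2], by simp [Circle.exp_sub, h3]⟩
  · intro σ
    obtain ⟨F, hF⟩ := Circle.exists_lift ((ContinuousMap.fst).comp σ)
    obtain ⟨G, hG⟩ := Circle.exists_lift ((ContinuousMap.fst.comp ContinuousMap.snd).comp σ)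
    obtain ⟨H, hH⟩ := Circle.exists_lift ((ContinuousMap.snd.comp ContinuousMap.snd).comp σ)
    refine ⟨F.prodMk (G.prodMk H), ?_⟩
    ext1 t
    exact Prod.ext (hF t) (Prod.ext (hG t) (hH t))
  · intro i
    fin_cases i <;> exact ⟨by simp, by simp, by simp⟩
  · rintro ⟨a, b, c⟩ ⟨h1, h2, h3⟩
    obtain ⟨m, rfl⟩ := Circle.exp_eq_one.1 h1
    obtain ⟨n, rfl⟩ := Circle.exp_eq_one.1 h2
    obtain ⟨l, rfl⟩ := Circle.exp_eq_one.1 h3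
    exact ⟨![m, n, l], by ext <;> simp [Fin.sum_univ_three]⟩
  · intro i t
    fin_cases i <;> simp [p, coordinateCircle, mul_comm]

/-- The coordinate projections of the fibre torus. -/
def fiberProj : Fin 2 → C(T2, Circle)
  | 0 => ContinuousMap.fst
  | 1 => ContinuousMap.snd

/-- The coordinate projections of `S¹ × S¹ × S¹`. -/
def torusProj : Fin 3 → C(T3, Circle)
  | 0 => ContinuousMap.fst
  | 1 => ContinuousMap.fst.comp ContinuousMap.snd
  | 2 => ContinuousMap.snd.comp ContinuousMap.snd

theorem winding_eq_one_of_comp_eq_id {X : Type} [TopologicalSpace X] {f : C(X, Circle)}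
    {γ : C(Circle, X)} (h : ∀ s, f (γ s) = s) : winding f (loopClass γ) = 1 := by
  rw [winding_loopClass f γ continuous_id fun t => (h _).symm]
  simp [Real.pi_ne_zero]

theorem winding_eq_zero_of_comp_const {X : Type} [TopologicalSpace X] {f : C(X, Circle)}
    {γ : C(Circle, X)} {c : Circle} (h : ∀ s, f (γ s) = c) : winding f (loopClass γ) = 0 := by
  obtain ⟨x, rfl⟩ := Circle.exp_surjective c
  rw [winding_loopClass f γ (continuous_const (y := x)) fun t => (h _).symm]
  simp

theorem winding_fiberBasis (i j : Fin 2) :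
    winding (fiberProj i) (fiberBasis j) = if i = j then 1 else 0 := by
  fin_cases i <;> fin_cases j <;>
    first
    | exact winding_eq_one_of_comp_eq_id fun s => rfl
    | exact winding_eq_zero_of_comp_const (c := 1) fun s => rfl

theorem winding_torusBasis (i j : Fin 3) :
    winding (torusProj i) (torusBasis j) = if i = j then 1 else 0 := by
  fin_cases i <;> fin_cases j <;>
    first
    | exact winding_eq_one_of_comp_eq_id fun s => rfl
    | exact winding_eq_zero_of_comp_const (c := 1) fun s => rfl

theorem winding_fiberBasis_sum (i : Fin 2) (n : Fin 2 → ℤ) :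
    winding (fiberProj i) (∑ j, n j • fiberBasis j) = n i := by
  fin_cases i <;> simp [map_zsmul, winding_fiberBasis]

theorem winding_torusBasis_sum (i : Fin 3) (n : Fin 3 → ℤ) :
    winding (torusProj i) (∑ j, n j • torusBasis j) = n i := by
  simp [map_sum, map_zsmul, winding_torusBasis]

/-- The coordinates of a class in `H₁(S¹ × T²; ℤ)`. -/
def torusCoord : H1 T3 ≃+ (Fin 3 → ℤ) :=
  (AddEquiv.ofBijective (AddMonoidHom.mk' (fun n : Fin 3 → ℤ => ∑ i, n i • torusBasis i)
    fun a b => by simp only [Pi.add_apply, add_zsmul, Finset.sum_add_distrib])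
    ⟨fun a b h => funext fun i => by
      have := congrArg (winding (torusProj i)) h
      simpa only [AddMonoidHom.mk'_apply, winding_torusBasis_sum, Int.cast_inj] using this,
    fun x => (exists_torusBasis_sum x).imp fun n h => h.symm⟩).symm

theorem torusCoord_symm_apply (n : Fin 3 → ℤ) :
    torusCoord.symm n = ∑ i, n i • torusBasis i := rfl

theorem torusCoord_cast (x : H1 T3) (i : Fin 3) :
    (torusCoord x i : ℝ) = winding (torusProj i) x := by
  obtain ⟨n, rfl⟩ := torusCoord.symm.surjective x
  rw [AddEquiv.apply_symm_apply, torusCoord_symm_apply, winding_torusBasis_sum]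

/-- The coordinates of a class in `H₁(T²; ℤ)`. -/
def fiberCoord : H1 T2 ≃+ (Fin 2 → ℤ) :=
  (AddEquiv.ofBijective (AddMonoidHom.mk' (fun n : Fin 2 → ℤ => ∑ i, n i • fiberBasis i)
    fun a b => by simp only [Pi.add_apply, add_zsmul, Finset.sum_add_distrib])
    ⟨fun a b h => funext fun i => by
      have := congrArg (winding (fiberProj i)) h
      simpa only [AddMonoidHom.mk'_apply, winding_fiberBasis_sum, Int.cast_inj] using this,
    fun x => (exists_fiberBasis_sum x).imp fun n h => h.symm⟩).symm

theorem fiberCoord_symm_apply (n : Fin 2 → ℤ) :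
    fiberCoord.symm n = ∑ i, n i • fiberBasis i := rfl

theorem fiberCoord_cast (x : H1 T2) (i : Fin 2) :
    (fiberCoord x i : ℝ) = winding (fiberProj i) x := by
  obtain ⟨n, rfl⟩ := fiberCoord.symm.surjective x
  rw [AddEquiv.apply_symm_apply, fiberCoord_symm_apply, winding_fiberBasis_sum]

theorem torusCoord_torusBasis (i j : Fin 3) :
    torusCoord (torusBasis j) i = if i = j then 1 else 0 := by
  have := torusCoord_cast (torusBasis j) i
  rw [winding_torusBasis] at this
  split_ifs at * <;> exact_mod_cast this

/-- The coordinates provide a matrix, and their uniqueness identifies it with the chosen one. -/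
theorem homologyMatrix_apply (g : Diffeomorph modelT3 modelT3 T3 T3 ∞) (i j : Fin 3) :
    homologyMatrix g i j = torusCoord (H1.map (T3map g) (torusBasis j)) i := by
  have h : ∃ A : Matrix (Fin 3) (Fin 3) ℤ,
      ∀ j, H1.map (T3map g) (torusBasis j) = ∑ i, A i j • torusBasis i :=
    ⟨fun i j => torusCoord (H1.map (T3map g) (torusBasis j)) i, fun j =>
      (torusCoord.symm_apply_apply _).symm⟩
  rw [homologyMatrix, dif_pos h]
  have := congrArg torusCoord (h.choose_spec j)
  rw [← torusCoord_symm_apply fun i => h.choose i j, AddEquiv.apply_symm_apply] at this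
  exact (congrFun this i).symm

theorem torusCoord_fiberInclusion (x : H1 T2) :
    torusCoord (H1.map fiberInclusion x) = ![0, fiberCoord x 0, fiberCoord x 1] := by
  funext i
  have := torusCoord_cast (H1.map fiberInclusion x) i
  rw [winding_map] at this
  fin_cases i
  · have h : (torusProj 0).comp fiberInclusion = 1 := rfl
    simp only [Fin.zero_eta, h, winding_one] at this
    simpa using this
  · have h : (torusProj 1).comp fiberInclusion = fiberProj 0 := rfl
    simp only [Fin.mk_one, h, ← fiberCoord_cast] at this
    simpa using this
  · have h : (torusProj 2).comp fiberInclusion = fiberProj 1 := rfl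
    simp only [Fin.reduceFinMk, h, ← fiberCoord_cast] at this
    simpa using this

theorem mem_fiberSubgroup {x : H1 T3} : x ∈ fiberSubgroup ↔ torusCoord x 0 = 0 := by
  constructor
  · rintro ⟨y, rfl⟩
    rw [torusCoord_fiberInclusion]
    rfl
  · intro h
    refine ⟨fiberCoord.symm ![torusCoord x 1, torusCoord x 2], torusCoord.injective ?_⟩
    rw [torusCoord_fiberInclusion, AddEquiv.apply_symm_apply]
    funext i
    fin_cases i <;> simp [h]

/-! ### The gluing maps -/

theorem winding_pow {X : Type} [TopologicalSpace X] (f : C(X, Circle)) (n : ℕ) (x : H1 X) :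
    winding (f ^ n) x = n * winding f x := by
  induction n with
  | zero => simp [winding_one]
  | succ n ih =>
    rw [pow_succ, winding_mul, ih]
    push_cast
    ring

/-- The diffeomorphism `(s, t, u) ↦ (t, tᵅ u, s⁻¹)` of the torus. -/
def gluingDiffeo (α : ℕ) : Diffeomorph modelT3 modelT3 T3 T3 ∞ where
  toFun p := (p.2.1, (p.2.1 ^ α * p.2.2, p.1⁻¹))
  invFun p := (p.2.2⁻¹, (p.1, (p.1 ^ α)⁻¹ * p.2.1))
  left_inv p := by simp
  right_inv p := by simp
  contMDiff_toFun := by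
    have h0 : ContMDiff modelT3 (𝓡 1) ∞ (fun p : T3 => p.1) := contMDiff_fst
    have h1 : ContMDiff modelT3 (𝓡 1) ∞ (fun p : T3 => p.2.1) := contMDiff_fst.comp contMDiff_snd
    have h2 : ContMDiff modelT3 (𝓡 1) ∞ (fun p : T3 => p.2.2) := contMDiff_snd.comp contMDiff_snd
    exact h1.prodMk (((h1.pow α).mul h2).prodMk h0.inv)
  contMDiff_invFun := by
    have h0 : ContMDiff modelT3 (𝓡 1) ∞ (fun p : T3 => p.1) := contMDiff_fst
    have h1 : ContMDiff modelT3 (𝓡 1) ∞ (fun p : T3 => p.2.1) := contMDiff_fst.comp contMDiff_snd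
    have h2 : ContMDiff modelT3 (𝓡 1) ∞ (fun p : T3 => p.2.2) := contMDiff_snd.comp contMDiff_snd
    exact h2.inv.prodMk (h0.prodMk ((h0.pow α).inv.mul h1))

/-- The components of the diffeomorphism are monomials in the coordinate projections, and winding
numbers turn monomials into linear forms. -/
theorem torusCoord_gluingDiffeo (α : ℕ) (x : H1 T3) :
    torusCoord (H1.map (T3map (gluingDiffeo α)) x) =
      ![torusCoord x 1, α * torusCoord x 1 + torusCoord x 2, -torusCoord x 0] := by
  funext i
  have := torusCoord_cast (H1.map (T3map (gluingDiffeo α)) x) i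
  rw [winding_map] at this
  fin_cases i
  · have h : (torusProj 0).comp (T3map (gluingDiffeo α)) = torusProj 1 := rfl
    simp only [Fin.zero_eta, h, ← torusCoord_cast] at this
    exact_mod_cast this
  · have h : (torusProj 1).comp (T3map (gluingDiffeo α)) = torusProj 1 ^ α * torusProj 2 := rfl
    simp only [Fin.mk_one, h, winding_mul, winding_pow, ← torusCoord_cast] at this
    exact_mod_cast this
  · have h : (torusProj 2).comp (T3map (gluingDiffeo α)) = (torusProj 0)⁻¹ := rfl
    simp only [Fin.reduceFinMk, h, winding_inv, ← torusCoord_cast] at this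
    exact_mod_cast this

theorem H1.map_T3map_symm (g : Diffeomorph modelT3 modelT3 T3 T3 ∞) (x : H1 T3) :
    H1.map (T3map g) (H1.map (T3map g.symm) x) = x := by
  rw [← H1.map_comp]
  have : (T3map g).comp (T3map g.symm) = ContinuousMap.id _ := by
    ext1 p
    exact g.apply_symm_apply p
  rw [this, H1.map_id]

theorem torusCoord_gluingDiffeo_symm (α : ℕ) (x : H1 T3) :
    torusCoord (H1.map (T3map (gluingDiffeo α).symm) x) =
      ![-torusCoord x 2, torusCoord x 0, torusCoord x 1 - α * torusCoord x 0] := by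
  obtain ⟨y, rfl⟩ : ∃ y, H1.map (T3map (gluingDiffeo α)) y = x := ⟨_, H1.map_T3map_symm _ x⟩
  have h : H1.map (T3map (gluingDiffeo α).symm) (H1.map (T3map (gluingDiffeo α)) y) = y :=
    H1.map_T3map_symm (gluingDiffeo α).symm y
  rw [h, torusCoord_gluingDiffeo]
  funext i
  fin_cases i <;> simp

/-- A cyclic permutation and a shear have determinant `1`; the inversion of `s` supplies the sign
demanded of an orientation-reversing gluing. -/
theorem det_homologyMatrix_gluingDiffeo (α : ℕ) :
    (homologyMatrix (gluingDiffeo α)).det = -1 := by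
  simp [Matrix.det_fin_three, homologyMatrix_apply, torusCoord_gluingDiffeo, torusCoord_torusBasis]

theorem det_homologyMatrix_gluingDiffeo_symm (α : ℕ) :
    (homologyMatrix (gluingDiffeo α).symm).det = -1 := by
  simp [Matrix.det_fin_three, homologyMatrix_apply, torusCoord_gluingDiffeo_symm,
    torusCoord_torusBasis]

theorem mem_map_fiberSubgroup_iff (g : Diffeomorph modelT3 modelT3 T3 T3 ∞) {x : H1 T3} :
    x ∈ fiberSubgroup.map (H1.map (T3map g)) ↔ torusCoord (H1.map (T3map g.symm) x) 0 = 0 := by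
  rw [AddSubgroup.mem_map]
  constructor
  · rintro ⟨y, hy, rfl⟩
    rwa [show H1.map (T3map g.symm) (H1.map (T3map g) y) = y from H1.map_T3map_symm g.symm y,
      ← mem_fiberSubgroup]
  · intro h
    exact ⟨_, mem_fiberSubgroup.2 h, H1.map_T3map_symm g x⟩

/-- The image is spanned by `z + α f¹` and `f¹`, hence by `z` and `f¹`. This independence of `α` is
why the intersection invariants cannot detect the parameter. -/
theorem mem_map_gluingDiffeo {α : ℕ} {x : H1 T3} :
    x ∈ fiberSubgroup.map (H1.map (T3map (gluingDiffeo α))) ↔ torusCoord x 2 = 0 := by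
  rw [mem_map_fiberSubgroup_iff, torusCoord_gluingDiffeo_symm]
  simp

theorem mem_map_gluingDiffeo_symm {α : ℕ} {x : H1 T3} :
    x ∈ fiberSubgroup.map (H1.map (T3map (gluingDiffeo α).symm)) ↔ torusCoord x 1 = 0 := by
  rw [mem_map_fiberSubgroup_iff]
  change torusCoord (H1.map (T3map (gluingDiffeo α)) x) 0 = 0 ↔ _
  rw [torusCoord_gluingDiffeo]
  simp

theorem map_gluingDiffeo_ne (α : ℕ) :
    fiberSubgroup.map (H1.map (T3map (gluingDiffeo α))) ≠ fiberSubgroup := by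
  intro h
  have h1 : torusBasis 0 ∈ fiberSubgroup.map (H1.map (T3map (gluingDiffeo α))) := by
    rw [mem_map_gluingDiffeo, torusCoord_torusBasis]
    simp
  rw [h, mem_fiberSubgroup, torusCoord_torusBasis] at h1
  simp at h1

theorem map_gluingDiffeo_symm_ne (α : ℕ) :
    fiberSubgroup.map (H1.map (T3map (gluingDiffeo α).symm)) ≠ fiberSubgroup := by
  intro h
  have h1 : torusBasis 0 ∈ fiberSubgroup.map (H1.map (T3map (gluingDiffeo α).symm)) := by
    rw [mem_map_gluingDiffeo_symm, torusCoord_torusBasis]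
    simp
  rw [h, mem_fiberSubgroup, torusCoord_torusBasis] at h1
  simp at h1

/-! ### Oriented charts of the flat torus -/

/-- The Euclidean plane. -/
abbrev E2 : Type := EuclideanSpace ℝ (Fin 2)

/-- The universal cover of the torus. -/
def torusCover : C(E2, T2) := ⟨fun x => (Circle.exp (x 0), Circle.exp (x 1)), by fun_prop⟩

theorem torusCover_apply (x : E2) : torusCover x = (Circle.exp (x 0), Circle.exp (x 1)) := rfl

theorem torusCover_surjective : Function.Surjective torusCover := by
  rintro ⟨z, w⟩
  obtain ⟨a, rfl⟩ := Circle.exp_surjective z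
  obtain ⟨b, rfl⟩ := Circle.exp_surjective w
  exact ⟨!₂[a, b], by simp [torusCover]⟩

theorem torusCover_add {x y : E2} (h : torusCover x = torusCover y) (z : E2) :
    torusCover (z + (y - x)) = torusCover z := by
  have h0 : Circle.exp (x 0) = Circle.exp (y 0) := congrArg Prod.fst h
  have h1 : Circle.exp (x 1) = Circle.exp (y 1) := congrArg Prod.snd h
  simp [torusCover, Circle.exp_add, Circle.exp_sub, h0, h1]

theorem isLocalHomeomorph_torusCover : IsLocalHomeomorph torusCover := by
  have h : IsLocalHomeomorph fun x : ℝ × ℝ => ((Circle.exp x.1, Circle.exp x.2) : T2) := by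
    intro x
    obtain ⟨e, he, he'⟩ := isLocalHomeomorph_circleExp x.1
    obtain ⟨f, hf, hf'⟩ := isLocalHomeomorph_circleExp x.2
    refine ⟨e.prod f, ⟨he, hf⟩, ?_⟩
    funext y
    exact Prod.ext (congrFun he' y.1) (congrFun hf' y.2)
  exact h.comp ((EuclideanSpace.equiv (Fin 2) ℝ).toHomeomorph.trans
    Homeomorph.finTwoArrow).isLocalHomeomorph

theorem det_E2 (A : E2 →L[ℝ] E2) : A.det =
    A (EuclideanSpace.single 0 1) 0 * A (EuclideanSpace.single 1 1) 1 -
      A (EuclideanSpace.single 1 1) 0 * A (EuclideanSpace.single 0 1) 1 := by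
  rw [ContinuousLinearMap.det, ← LinearMap.det_toMatrix (EuclideanSpace.basisFun (Fin 2) ℝ).toBasis,
    Matrix.det_fin_two]
  simp [LinearMap.toMatrix_apply]

theorem map_E2 (A : E2 →L[ℝ] E2) (u : E2) (i : Fin 2) : A u i =
    u 0 * A (EuclideanSpace.single 0 1) i + u 1 * A (EuclideanSpace.single 1 1) i := by
  have : u = u 0 • EuclideanSpace.single 0 1 + u 1 • EuclideanSpace.single 1 1 := by
    ext j
    fin_cases j <;> simp
  conv_lhs => rw [this]
  simp

/-- Scaling of oriented area; it will decide the direction of a boundary circle from a tangent and a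
normal vector. -/
theorem det_E2_mul (A : E2 →L[ℝ] E2) (u v : E2) :
    A u 0 * A v 1 - A v 0 * A u 1 = A.det * (u 0 * v 1 - v 0 * u 1) := by
  rw [det_E2, map_E2 A u 0, map_E2 A u 1, map_E2 A v 0, map_E2 A v 1]
  ring

/-- Positively oriented smooth charts of the torus. -/
def IsOrientedChart (e : OpenPartialHomeomorph T2 E2) : Prop :=
  ∀ x, torusCover x ∈ e.source →
    ContDiffAt ℝ ∞ (e ∘ torusCover) x ∧ 0 < (fderiv ℝ (e ∘ torusCover) x).det

/-- Near `y` the transition map is `e' ∘ torusCover` composed with a local inverse of `e ∘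
torusCover`, hence smooth. By the chain rule its Jacobian is a quotient of two positive ones. -/
theorem IsOrientedChart.transition {e e' : OpenPartialHomeomorph T2 E2} (he : IsOrientedChart e)
    (he' : IsOrientedChart e') {y : E2} (hy : y ∈ e.target) (hy' : e.symm y ∈ e'.source) :
    ContDiffAt ℝ ∞ (e' ∘ e.symm) y ∧ 0 < (fderiv ℝ (e' ∘ e.symm) y).det := by
  obtain ⟨x, hx⟩ := torusCover_surjective (e.symm y)
  obtain ⟨h1, h2⟩ := he x (hx ▸ e.map_target hy)
  obtain ⟨h3, h4⟩ := he' x (hx ▸ hy')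
  have hyx : (e ∘ torusCover) x = y := by simp [hx, e.right_inv hy]
  let D := (fderiv ℝ (e ∘ torusCover) x).toContinuousLinearEquivOfDetNeZero h2.ne'
  have hD : HasFDerivAt (e ∘ torusCover) (D : E2 →L[ℝ] E2) x :=
    (h1.differentiableAt (by simp)).hasFDerivAt
  set ψ := h1.toOpenPartialHomeomorph _ hD (by simp) with hψ
  have hψc : (ψ : E2 → E2) = e ∘ torusCover := h1.toOpenPartialHomeomorph_coe hD (by simp)
  have hxs : x ∈ ψ.source := h1.mem_toOpenPartialHomeomorph_source hD (by simp)
  have hyt : y ∈ ψ.target := by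
    have := ψ.map_source hxs
    rwa [hψc, hyx] at this
  have hιy : ψ.symm y = x := by
    rw [← hyx, ← hψc, ψ.left_inv hxs]
  have hι : ContDiffAt ℝ ∞ ψ.symm y := by
    have := h1.to_localInverse hD (by simp)
    rw [hyx] at this
    exact this
  have hev : e' ∘ e.symm =ᶠ[nhds y] (e' ∘ torusCover) ∘ ψ.symm := by
    have c1 : ContinuousAt (torusCover ∘ ψ.symm) y :=
      torusCover.continuous.continuousAt.comp (ψ.continuousAt_symm hyt)
    have hs : e.source ∈ nhds ((torusCover ∘ ψ.symm) y) := by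
      rw [Function.comp_apply, hιy, hx]
      exact e.open_source.mem_nhds (e.map_target hy)
    filter_upwards [c1 hs, ψ.open_target.mem_nhds hyt] with z hz hz'
    have := ψ.right_inv hz'
    rw [hψc, Function.comp_apply] at this
    simp only [Function.comp_apply]
    congr 1
    exact (congrArg e.symm this).symm.trans (e.left_inv hz)
  have h3' : ContDiffAt ℝ ∞ (e' ∘ torusCover) (ψ.symm y) := by rwa [hιy]
  refine ⟨(h3'.comp y hι).congr_of_eventuallyEq hev, ?_⟩
  have key : (e' ∘ e.symm) ∘ (e ∘ torusCover) =ᶠ[nhds x] e' ∘ torusCover := by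
    have hs : torusCover ⁻¹' e.source ∈ nhds x :=
      torusCover.continuous.continuousAt (hx ▸ e.open_source.mem_nhds (e.map_target hy))
    filter_upwards [hs] with z hz
    simp [e.left_inv hz]
  have hdiff : DifferentiableAt ℝ (e' ∘ e.symm) ((e ∘ torusCover) x) := by
    rw [hyx]
    exact ((h3'.comp y hι).congr_of_eventuallyEq hev).differentiableAt (by simp)
  have hcomp := fderiv_comp x hdiff (h1.differentiableAt (by simp))
  rw [key.fderiv_eq, hyx] at hcomp
  rw [hcomp] at h4
  have hdet (A B : E2 →L[ℝ] E2) : (A.comp B).det = A.det * B.det := by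
    simp [ContinuousLinearMap.det, LinearMap.det_comp]
  rw [hdet] at h4
  exact (pos_iff_pos_of_mul_pos h4).2 h2

/-- A function with nonzero differential is the first coordinate of an oriented chart. -/
theorem exists_isOrientedChart {F : E2 → ℝ} (hF : ContDiff ℝ ∞ F) {x : E2}
    (hx : fderiv ℝ F x ≠ 0) {U : Set E2} (hU : IsOpen U) (hxU : x ∈ U) :
    ∃ e : OpenPartialHomeomorph T2 E2, IsOrientedChart e ∧ torusCover x ∈ e.source ∧
      e (torusCover x) 0 = F x ∧
      ∀ p ∈ e.source, ∃ y ∈ U, torusCover y = p ∧ e p 0 = F y := by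
  obtain ⟨ql, hxl, hql⟩ := isLocalHomeomorph_torusCover x
  set a := fderiv ℝ F x (EuclideanSpace.single 0 1) with ha
  set b := fderiv ℝ F x (EuclideanSpace.single 1 1) with hb
  -- The second coordinate is linear with gradient `(-b, a)`, the gradient of `F` at `x` rotated by
  -- a quarter turn, so the Jacobian at `x` is `a² + b² > 0`.
  let Ψ : E2 → E2 := fun y => !₂[F y, -b * y 0 + a * y 1]
  have hΨ : ContDiff ℝ ∞ Ψ := by
    rw [contDiff_euclidean]
    intro i
    fin_cases i
    · simpa [Ψ] using hF
    · simp only [Ψ]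
      simp
      fun_prop
  have hdet : 0 < (fderiv ℝ Ψ x).det := by
    have h0 (u : E2) : fderiv ℝ Ψ x u 0 = fderiv ℝ F x u := by
      have := ((EuclideanSpace.proj (0 : Fin 2) : E2 →L[ℝ] ℝ).hasFDerivAt.comp x
        (hΨ.differentiable (by simp) x).hasFDerivAt).fderiv
      have e : (EuclideanSpace.proj (0 : Fin 2) : E2 →L[ℝ] ℝ) ∘ Ψ = F := by
        ext y
        simp [Ψ]
      rw [e] at this
      rw [this]
      rfl
    have h1 (u : E2) : fderiv ℝ Ψ x u 1 = -b * u 0 + a * u 1 := by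
      have := ((EuclideanSpace.proj (1 : Fin 2) : E2 →L[ℝ] ℝ).hasFDerivAt.comp x
        (hΨ.differentiable (by simp) x).hasFDerivAt).fderiv
      have e : (EuclideanSpace.proj (1 : Fin 2) : E2 →L[ℝ] ℝ) ∘ Ψ =
        (-b • (EuclideanSpace.proj (0 : Fin 2) : E2 →L[ℝ] ℝ) +
          a • (EuclideanSpace.proj (1 : Fin 2) : E2 →L[ℝ] ℝ) : E2 →L[ℝ] ℝ) := by
        ext y
        simp [Ψ]
      rw [e, ContinuousLinearMap.fderiv] at this
      have := DFunLike.congr_fun this u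
      simp at this
      linarith
    rw [det_E2, h0, h0, h1, h1, ← ha, ← hb]
    have hab : a ≠ 0 ∨ b ≠ 0 := by
      by_contra! h
      apply hx
      ext u
      have : u = u 0 • EuclideanSpace.single 0 1 + u 1 • EuclideanSpace.single 1 1 := by
        ext j
        fin_cases j <;> simp
      rw [this, map_add, map_smul, map_smul, ← ha, ← hb, h.1, h.2]
      simp
    simp
    rcases hab with h | h <;>
      nlinarith [mul_self_pos.2 h, mul_self_nonneg a, mul_self_nonneg b]
  -- Positivity of the Jacobian is required on the whole chart domain, so the domain is shrunk to
  -- where it holds.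
  let V : Set E2 := U ∩ {y | 0 < (fderiv ℝ Ψ y).det}
  have hV : IsOpen V := hU.inter (isOpen_lt continuous_const
    (ContinuousLinearMap.continuous_det.comp (hΨ.continuous_fderiv (by simp))))
  let D := (fderiv ℝ Ψ x).toContinuousLinearEquivOfDetNeZero hdet.ne'
  have hD : HasFDerivAt Ψ (D : E2 →L[ℝ] E2) x := (hΨ.differentiable (by simp) x).hasFDerivAt
  set ψ := hΨ.contDiffAt.toOpenPartialHomeomorph _ hD (by simp) with hψ
  have hψc : (ψ : E2 → E2) = Ψ := hΨ.contDiffAt.toOpenPartialHomeomorph_coe hD (by simp)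
  have hxs : x ∈ ψ.source := hΨ.contDiffAt.mem_toOpenPartialHomeomorph_source hD (by simp)
  have hlx : ql.symm (torusCover x) = x := by rw [hql, ql.left_inv hxl]
  let e := ql.symm ≫ₕ ψ.restrOpen V hV
  have hes {p : T2} : p ∈ e.source ↔ p ∈ ql.target ∧ ql.symm p ∈ ψ.source ∧ ql.symm p ∈ V := by
    simp [e]
  have hec (p : T2) : e p = Ψ (ql.symm p) := by
    change ψ (ql.symm p) = _
    rw [hψc]
  refine ⟨e, ?_, ?_, ?_, ?_⟩
  · intro y hy
    obtain ⟨h1, h2, h3⟩ := hes.1 hy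
    set y' := ql.symm (torusCover y) with hy'
    have hyy : torusCover y = torusCover y' := by
      have := ql.right_inv h1
      rw [← hql] at this
      exact this.symm
    have hy's : y' ∈ ql.source := ql.map_target h1
    have hev : e ∘ torusCover =ᶠ[nhds y] fun z => Ψ (z + (y' - y)) := by
      have hc : ContinuousAt (fun z => z + (y' - y)) y := by fun_prop
      have hs : ql.source ∈ nhds (y + (y' - y)) := by
        rw [add_sub_cancel]
        exact ql.open_source.mem_nhds hy's
      filter_upwards [hc hs] with z hz
      rw [Function.comp_apply, hec, ← torusCover_add hyy z, hql, ql.left_inv hz]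
    constructor
    · exact (hΨ.comp (contDiff_id.add contDiff_const)).contDiffAt.congr_of_eventuallyEq hev
    · rw [hev.fderiv_eq, fderiv_comp_add_right, add_sub_cancel]
      exact h3.2
  · rw [hes, hlx]
    refine ⟨?_, hxs, hxU, hdet⟩
    rw [hql]
    exact ql.map_source hxl
  · rw [hec, hlx]
    simp [Ψ]
  · intro p hp
    obtain ⟨h1, h2, h3⟩ := hes.1 hp
    refine ⟨ql.symm p, h3.1, ?_, ?_⟩
    · rw [hql, ql.right_inv h1]
    · rw [hec]
      simp [Ψ]

/-! ### The two-holed torus as a surface with boundary -/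

/-- A defining function of the two-holed torus. -/
def holeHeight (p : T2) : ℝ := 1 - ((p.1 : ℂ).re + (p.2 : ℂ).re) ^ 2

theorem continuous_holeHeight : Continuous holeHeight := by
  unfold holeHeight
  fun_prop

/-- On the unit circle `‖z ∓ 1‖² = 2 ∓ 2 re z`, so the two inequalities together say `|re p.1 + re
p.2| ≤ 1`. -/
theorem mem_twoHoledTorus {p : T2} : p ∈ twoHoledTorus ↔ 0 ≤ holeHeight p := by
  have h (z : Circle) : (z : ℂ).re * (z : ℂ).re + (z : ℂ).im * (z : ℂ).im = 1 := by
    have := Circle.normSq_coe z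
    rwa [Complex.normSq_apply] at this
  have h1 (z : Circle) : ‖(z : ℂ) - 1‖ ^ 2 = 2 - 2 * (z : ℂ).re := by
    rw [← Complex.normSq_eq_norm_sq, Complex.normSq_apply]
    simp only [Complex.sub_re, Complex.sub_im, Complex.one_re, Complex.one_im]
    linarith [h z]
  have h2 (z : Circle) : ‖(z : ℂ) + 1‖ ^ 2 = 2 + 2 * (z : ℂ).re := by
    rw [← Complex.normSq_eq_norm_sq, Complex.normSq_apply]
    simp only [Complex.add_re, Complex.add_im, Complex.one_re, Complex.one_im]
    linarith [h z]
  simp only [twoHoledTorus, Set.mem_ofPred_eq, h1, h2, holeHeight]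
  rw [sub_nonneg, sq_le_one_iff_abs_le_one, abs_le]
  constructor <;> rintro ⟨a, b⟩ <;> constructor <;> linarith

theorem holeHeight_torusCover (x : E2) :
    holeHeight (torusCover x) = 1 - (Real.cos (x 0) + Real.cos (x 1)) ^ 2 := by
  simp [holeHeight, torusCover, Circle.coe_exp, Complex.exp_ofReal_mul_I_re]

instance : CompactSpace twoHoledTorus := by
  apply isCompact_iff_compactSpace.1
  apply IsClosed.isCompact
  have : twoHoledTorus = holeHeight ⁻¹' Set.Ici 0 := by
    ext p
    exact mem_twoHoledTorus
  rw [this]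
  exact isClosed_Ici.preimage continuous_holeHeight

instance : Nonempty twoHoledTorus :=
  ⟨⟨torusCover !₂[0, Real.pi], mem_twoHoledTorus.2 (by simp [holeHeight_torusCover])⟩⟩

/-- An oriented chart of the torus adapted to the two-holed torus: the first coordinate either is
the defining function or is positive, inside the interior. -/
structure IsAdaptedChart (e : OpenPartialHomeomorph T2 E2) : Prop where
  oriented : IsOrientedChart e
  height : (∀ p ∈ e.source, e p 0 = holeHeight p) ∨ ∀ p ∈ e.source, 0 < holeHeight p ∧ 0 < e p 0

theorem IsAdaptedChart.mem_iff {e : OpenPartialHomeomorph T2 E2} (he : IsAdaptedChart e) {p : T2}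
    (hp : p ∈ e.source) : p ∈ twoHoledTorus ↔ 0 ≤ e p 0 := by
  rw [mem_twoHoledTorus]
  rcases he.height with h | h
  · rw [h p hp]
  · exact iff_of_true (h p hp).1.le (h p hp).2.le

theorem IsAdaptedChart.height_eq_zero_iff {e : OpenPartialHomeomorph T2 E2} (he : IsAdaptedChart e)
    {p : T2} (hp : p ∈ e.source) : holeHeight p = 0 ↔ e p 0 = 0 := by
  rcases he.height with h | h
  · rw [h p hp]
  · exact iff_of_false (h p hp).1.ne' (h p hp).2.ne'

theorem halfPlane_symm_eq {y : E2} (hy : 0 ≤ y 0) : ((𝓡∂ 2).symm y).1 = y :=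
  (𝓡∂ 2).right_inv (by rw [range_modelWithCornersEuclideanHalfSpace]; exact hy)

open Classical in
/-- The restriction of an adapted chart to the two-holed torus. -/
def holedChart (e : OpenPartialHomeomorph T2 E2) (he : IsAdaptedChart e) :
    OpenPartialHomeomorph twoHoledTorus (EuclideanHalfSpace 2) where
  toFun p := (𝓡∂ 2).symm (e p.1)
  -- Points of the half-plane in `e.target` always satisfy the condition; the arbitrary value is
  -- taken only outside the target.
  invFun y := if h : e.symm y.1 ∈ twoHoledTorus then ⟨_, h⟩ else Classical.arbitrary _
  source := Subtype.val ⁻¹' e.source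
  target := Subtype.val ⁻¹' e.target
  map_source' p hp := by
    change ((𝓡∂ 2).symm (e p.1)).1 ∈ e.target
    rw [halfPlane_symm_eq ((he.mem_iff hp).1 p.2)]
    exact e.map_source hp
  map_target' y hy := by
    have hs : e.symm y.1 ∈ e.source := e.map_target hy
    have h : e.symm y.1 ∈ twoHoledTorus := by
      rw [he.mem_iff hs, e.right_inv hy]
      exact y.2
    rw [dif_pos h]
    exact hs
  left_inv' p hp := by
    have h1 := halfPlane_symm_eq ((he.mem_iff hp).1 p.2)
    have h : e.symm ((𝓡∂ 2).symm (e p.1)).1 = p.1 := by rw [h1, e.left_inv hp]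
    rw [dif_pos (by rw [h]; exact p.2)]
    exact Subtype.ext h
  right_inv' y hy := by
    have hs : e.symm y.1 ∈ e.source := e.map_target hy
    have h : e.symm y.1 ∈ twoHoledTorus := by
      rw [he.mem_iff hs, e.right_inv hy]
      exact y.2
    rw [dif_pos h]
    apply Subtype.ext
    change ((𝓡∂ 2).symm (e (e.symm y.1))).1 = y.1
    rw [halfPlane_symm_eq ((he.mem_iff hs).1 h), e.right_inv hy]
  open_source := e.open_source.preimage continuous_subtype_val
  open_target := e.open_target.preimage continuous_subtype_val
  continuousOn_toFun := (𝓡∂ 2).continuous_symm.comp_continuousOn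
    (e.continuousOn.comp continuous_subtype_val.continuousOn fun _ h => h)
  continuousOn_invFun := by
    rw [Topology.IsInducing.subtypeVal.continuousOn_iff]
    refine (e.continuousOn_symm.comp continuous_subtype_val.continuousOn fun _ h => h).congr ?_
    intro y hy
    have hs : e.symm y.1 ∈ e.source := e.map_target hy
    have h : e.symm y.1 ∈ twoHoledTorus := by
      rw [he.mem_iff hs, e.right_inv hy]
      exact y.2
    simp only [Function.comp_apply]
    rw [dif_pos h]

theorem holedChart_apply {e : OpenPartialHomeomorph T2 E2} (he : IsAdaptedChart e)
    {p : twoHoledTorus} (hp : p.1 ∈ e.source) : (holedChart e he p).1 = e p.1 :=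
  halfPlane_symm_eq ((he.mem_iff hp).1 p.2)

theorem mem_holedChart_source {e : OpenPartialHomeomorph T2 E2} (he : IsAdaptedChart e)
    {p : twoHoledTorus} : p ∈ (holedChart e he).source ↔ p.1 ∈ e.source := Iff.rfl

theorem mem_holedChart_target {e : OpenPartialHomeomorph T2 E2} (he : IsAdaptedChart e)
    {y : EuclideanHalfSpace 2} : y ∈ (holedChart e he).target ↔ y.1 ∈ e.target := Iff.rfl

theorem holedChart_symm_apply {e : OpenPartialHomeomorph T2 E2} (he : IsAdaptedChart e)
    {y : EuclideanHalfSpace 2} (hy : y.1 ∈ e.target) :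
    ((holedChart e he).symm y).1 = e.symm y.1 := by
  have hs : e.symm y.1 ∈ e.source := e.map_target hy
  have h : e.symm y.1 ∈ twoHoledTorus := by
    rw [he.mem_iff hs, e.right_inv hy]
    exact y.2
  exact congrArg Subtype.val (dif_pos h)

/-- At a zero of the height `cos x₀ + cos x₁ = ±1`. A critical point there would have both sines
zero, hence both cosines `±1`, and their sum would be `0` or `±2`. -/
theorem holeHeight_deriv_ne_zero {x : E2} (hx : holeHeight (torusCover x) = 0) :
    fderiv ℝ (fun y => holeHeight (torusCover y)) x ≠ 0 := by
  intro h
  rw [holeHeight_torusCover] at hx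
  have hd (i : Fin 2) : HasFDerivAt (fun y : E2 => Real.cos (y i))
      (-Real.sin (x i) • (EuclideanSpace.proj i : E2 →L[ℝ] ℝ)) x := by
    have := (EuclideanSpace.proj i : E2 →L[ℝ] ℝ).hasFDerivAt (x := x)
    exact this.cos
  have h1 := (((hd 0).add (hd 1)).pow 2).const_sub 1
  have h2 : (fun y : E2 => holeHeight (torusCover y)) =
      fun y => 1 - (Real.cos (y 0) + Real.cos (y 1)) ^ 2 := funext holeHeight_torusCover
  rw [h2] at h
  have h3 := h1.fderiv.symm.trans h
  set c := Real.cos (x 0) + Real.cos (x 1) with hc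
  have hc1 : c ≠ 0 := by
    intro h0
    rw [h0] at hx
    norm_num at hx
  have e0 := DFunLike.congr_fun h3 (EuclideanSpace.single 0 1)
  have e1 := DFunLike.congr_fun h3 (EuclideanSpace.single 1 1)
  simp [← hc, hc1] at e0 e1
  have q0 := Real.sin_sq_add_cos_sq (x 0)
  have q1 := Real.sin_sq_add_cos_sq (x 1)
  rw [e0] at q0
  rw [e1] at q1
  have r0 : Real.cos (x 0) = 1 ∨ Real.cos (x 0) = -1 := by
    rw [← sq_eq_one_iff]
    linarith
  have r1 : Real.cos (x 1) = 1 ∨ Real.cos (x 1) = -1 := by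
    rw [← sq_eq_one_iff]
    linarith
  rcases r0 with r0 | r0 <;> rcases r1 with r1 | r1 <;> rw [hc, r0, r1] at hx <;> norm_num at hx

theorem contDiff_holeHeight : ContDiff ℝ ∞ fun y : E2 => holeHeight (torusCover y) := by
  rw [funext holeHeight_torusCover]
  have h (i : Fin 2) : ContDiff ℝ ∞ fun y : E2 => y i :=
    (EuclideanSpace.proj i : E2 →L[ℝ] ℝ).contDiff
  exact contDiff_const.sub ((((h 0).cos).add (h 1).cos).pow 2)

theorem exists_isAdaptedChart (p : twoHoledTorus) :
    ∃ e : OpenPartialHomeomorph T2 E2, IsAdaptedChart e ∧ p.1 ∈ e.source := by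
  obtain ⟨x, hx⟩ := torusCover_surjective p.1
  have hp := mem_twoHoledTorus.1 p.2
  rcases hp.eq_or_lt with h0 | h0
  · obtain ⟨e, he, hxe, -, h⟩ := exists_isOrientedChart contDiff_holeHeight
      (holeHeight_deriv_ne_zero (by rw [hx, ← h0])) isOpen_univ (Set.mem_univ x)
    refine ⟨e, ⟨he, .inl fun p hp => ?_⟩, hx ▸ hxe⟩
    obtain ⟨y, -, rfl, hy⟩ := h p hp
    exact hy
  · let F : E2 → ℝ := fun y => 1 - x 0 + y 0
    have hF : ContDiff ℝ ∞ F :=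
      contDiff_const.add (EuclideanSpace.proj (0 : Fin 2) : E2 →L[ℝ] ℝ).contDiff
    have hd : HasFDerivAt F (EuclideanSpace.proj (0 : Fin 2) : E2 →L[ℝ] ℝ) x :=
      (EuclideanSpace.proj (0 : Fin 2) : E2 →L[ℝ] ℝ).hasFDerivAt.const_add _
    have hd0 : fderiv ℝ F x ≠ 0 := by
      rw [hd.fderiv]
      intro h
      have := DFunLike.congr_fun h (EuclideanSpace.single 0 1)
      simp at this
    let U : Set E2 := {y | 0 < holeHeight (torusCover y)} ∩ {y | 0 < F y}
    have hU : IsOpen U := (isOpen_lt continuous_const contDiff_holeHeight.continuous).inter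
      (isOpen_lt continuous_const hF.continuous)
    obtain ⟨e, he, hxe, -, h⟩ := exists_isOrientedChart hF hd0 hU
      (show x ∈ U from ⟨by simpa [hx] using h0, by simp [F]⟩)
    refine ⟨e, ⟨he, .inr fun p hp => ?_⟩, hx ▸ hxe⟩
    obtain ⟨y, hyU, rfl, hy⟩ := h p hp
    exact ⟨hyU.1, hy ▸ hyU.2⟩

/-- The oriented atlas of the two-holed torus. -/
def holedAtlas : Set (OpenPartialHomeomorph twoHoledTorus (EuclideanHalfSpace 2)) :=
  {c | ∃ e, ∃ he : IsAdaptedChart e, holedChart e he = c}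

instance : ChartedSpace (EuclideanHalfSpace 2) twoHoledTorus where
  atlas := holedAtlas
  chartAt p := holedChart (exists_isAdaptedChart p).choose (exists_isAdaptedChart p).choose_spec.1
  mem_chart_source p := (exists_isAdaptedChart p).choose_spec.2
  chart_mem_atlas _ := ⟨_, _, rfl⟩

theorem chartAt_twoHoledTorus (p : twoHoledTorus) : ∃ e, ∃ he : IsAdaptedChart e,
    p.1 ∈ e.source ∧ chartAt (EuclideanHalfSpace 2) p = holedChart e he :=
  ⟨_, (exists_isAdaptedChart p).choose_spec.1, (exists_isAdaptedChart p).choose_spec.2, rfl⟩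

instance : IsManifold (𝓡∂ 2) ∞ twoHoledTorus := by
  apply isManifold_of_contDiffOn
  rintro _ _ ⟨e, he, rfl⟩ ⟨e', he', rfl⟩ y ⟨hy, hyr⟩
  -- On the half-plane the transition map agrees with that of the ambient torus charts, which is
  -- smooth on a full neighbourhood.
  have key : ∀ z ∈ (𝓡∂ 2).symm ⁻¹' ((holedChart e he).symm ≫ₕ holedChart e' he').source ∩
      Set.range (𝓡∂ 2), z ∈ e.target ∧ e.symm z ∈ e'.source ∧
      ((𝓡∂ 2) ∘ (holedChart e he).symm ≫ₕ holedChart e' he' ∘ (𝓡∂ 2).symm) z =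
        (e' ∘ e.symm) z := by
    rintro z ⟨hz, hzr⟩
    rw [range_modelWithCornersEuclideanHalfSpace] at hzr
    have hzz := halfPlane_symm_eq hzr
    rw [Set.mem_preimage, OpenPartialHomeomorph.trans_source, Set.mem_inter_iff,
      OpenPartialHomeomorph.symm_source, mem_holedChart_target, hzz, Set.mem_preimage,
      mem_holedChart_source, holedChart_symm_apply he (by rw [hzz]; exact hz.1), hzz] at hz
    refine ⟨hz.1, hz.2, ?_⟩
    have h1 := holedChart_symm_apply he (y := (𝓡∂ 2).symm z) (by rw [hzz]; exact hz.1)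
    rw [hzz] at h1
    change (holedChart e' he' ((holedChart e he).symm ((𝓡∂ 2).symm z))).1 = e' (e.symm z)
    rw [holedChart_apply he' (by rw [h1]; exact hz.2), h1]
  obtain ⟨h1, h2, -⟩ := key y ⟨hy, hyr⟩
  exact ((he.oriented.transition he'.oriented h1 h2).1.contDiffWithinAt).congr
    (fun z hz => (key z hz).2.2) (key y ⟨hy, hyr⟩).2.2

/-- Half-planes have unique derivatives, so the derivative within the half-plane is that of the
ambient transition map. -/
theorem holedAtlas_pos {c c' : OpenPartialHomeomorph twoHoledTorus (EuclideanHalfSpace 2)}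
    (hc : c ∈ holedAtlas) (hc' : c' ∈ holedAtlas) {p : twoHoledTorus}
    (hp : p ∈ c.source ∩ c'.source) :
    0 < (fderivWithin ℝ (c'.extend (𝓡∂ 2) ∘ (c.extend (𝓡∂ 2)).symm)
        (Set.range (𝓡∂ 2)) (c.extend (𝓡∂ 2) p)).det := by
  obtain ⟨e, he, rfl⟩ := hc
  obtain ⟨e', he', rfl⟩ := hc'
  have hy : (holedChart e he).extend (𝓡∂ 2) p = e p.1 := holedChart_apply he hp.1
  rw [hy]
  have hye : e p.1 ∈ e.target := e.map_source hp.1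
  have hye' : e.symm (e p.1) ∈ e'.source := by
    rw [e.left_inv hp.1]
    exact hp.2
  obtain ⟨h1, h2⟩ := he.oriented.transition he'.oriented hye hye'
  have hr : e p.1 ∈ Set.range (𝓡∂ 2) := ⟨_, hy⟩
  have hpt : ∀ z ∈ Set.range (𝓡∂ 2), z ∈ e.target → e.symm z ∈ e'.source →
      ((holedChart e' he').extend (𝓡∂ 2) ∘ ((holedChart e he).extend (𝓡∂ 2)).symm) z =
        (e' ∘ e.symm) z := by
    intro z hzr hz hz'
    rw [range_modelWithCornersEuclideanHalfSpace] at hzr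
    have hzz := halfPlane_symm_eq hzr
    have h1 := holedChart_symm_apply he (y := (𝓡∂ 2).symm z) (by rw [hzz]; exact hz)
    rw [hzz] at h1
    change (holedChart e' he' ((holedChart e he).symm ((𝓡∂ 2).symm z))).1 = e' (e.symm z)
    rw [holedChart_apply he' (by rw [h1]; exact hz'), h1]
  have hev : ((holedChart e' he').extend (𝓡∂ 2) ∘ ((holedChart e he).extend (𝓡∂ 2)).symm)
      =ᶠ[nhdsWithin (e p.1) (Set.range (𝓡∂ 2))] (e' ∘ e.symm) := by
    have a1 := e.open_target.mem_nhds hye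
    have a2 := (e.continuousAt_symm hye) (e'.open_source.mem_nhds hye')
    filter_upwards [self_mem_nhdsWithin, mem_nhdsWithin_of_mem_nhds a1,
      mem_nhdsWithin_of_mem_nhds a2] with z b1 b2 b3
    exact hpt z b1 b2 b3
  rw [hev.fderivWithin_eq (hpt _ hr hye hye'),
    ((h1.differentiableAt (by simp)).hasFDerivAt.hasFDerivWithinAt).fderivWithin
      ((𝓡∂ 2).uniqueDiffOn _ hr)]
  exact h2

theorem mem_boundary_twoHoledTorus {p : twoHoledTorus} :
    p ∈ (𝓡∂ 2).boundary twoHoledTorus ↔ holeHeight p.1 = 0 := by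
  obtain ⟨e, he, hp, hc⟩ := chartAt_twoHoledTorus p
  have h1 : extChartAt (𝓡∂ 2) p p = e p.1 := by
    rw [extChartAt, hc]
    exact holedChart_apply he hp
  change extChartAt (𝓡∂ 2) p p ∈ frontier (Set.range (𝓡∂ 2)) ↔ _
  rw [h1, frontier_range_modelWithCornersEuclideanHalfSpace, he.height_eq_zero_iff hp]
  exact eq_comm

/-! ### Collars of the boundary of the two-holed torus -/

/-- The centre of a hole. -/
def holeCenter (b : Bool) : ℝ := if b then 0 else Real.pi

/-- Coordinates around a hole in which the hole is a round disk. -/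
def holeLift (b : Bool) (u v : ℝ) : E2 :=
  !₂[holeCenter b + 2 * Real.arcsin u, holeCenter b - 2 * Real.arcsin v]

theorem continuous_holeLift (b : Bool) : Continuous fun p : ℝ × ℝ => holeLift b p.1 p.2 := by
  unfold holeLift
  have := Real.continuous_arcsin
  fun_prop

theorem cos_two_mul_arcsin {u : ℝ} (hu : |u| ≤ 1) :
    Real.cos (2 * Real.arcsin u) = 1 - 2 * u ^ 2 := by
  rw [Real.cos_two_mul, Real.cos_sq', Real.sin_arcsin (neg_le_of_abs_le hu) (le_of_abs_le hu)]
  ring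

/-- The half-angle substitution makes the level curves of `cos x₀ + cos x₁` round circles. The value
is `±1`, the edge of the hole, at radius `√2 / 2`, and `0` at radius `1`, where the two collars
meet. -/
theorem cos_add_cos_holeLift (b : Bool) {u v : ℝ} (hu : |u| ≤ 1) (hv : |v| ≤ 1) :
    Real.cos (holeLift b u v 0) + Real.cos (holeLift b u v 1) =
      (if b then 1 else -1) * (2 - 2 * (u ^ 2 + v ^ 2)) := by
  cases b
  · simp only [holeLift, holeCenter]
    simp [Real.cos_pi_sub, add_comm Real.pi, Real.cos_add_pi, cos_two_mul_arcsin hu,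
      cos_two_mul_arcsin hv]
    ring
  · simp only [holeLift, holeCenter]
    simp [cos_two_mul_arcsin hu, cos_two_mul_arcsin hv]
    ring

theorem holeHeight_holeLift (b : Bool) {u v : ℝ} (hu : |u| ≤ 1) (hv : |v| ≤ 1) :
    holeHeight (torusCover (holeLift b u v)) = 1 - (2 - 2 * (u ^ 2 + v ^ 2)) ^ 2 := by
  rw [holeHeight_torusCover, cos_add_cos_holeLift b hu hv]
  cases b <;> simp
  ring

theorem abs_le_one_of_sq {u v r : ℝ} (h : u ^ 2 + v ^ 2 = r ^ 2) (hr : r ^ 2 ≤ 1) :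
    |u| ≤ 1 ∧ |v| ≤ 1 := by
  rw [← sq_le_one_iff_abs_le_one, ← sq_le_one_iff_abs_le_one]
  exact ⟨by nlinarith [sq_nonneg v], by nlinarith [sq_nonneg u]⟩

/-- The radius of a hole. -/
def holeRadius : ℝ := √2 / 2

theorem holeRadius_sq : holeRadius ^ 2 = 1 / 2 := by
  rw [holeRadius, div_pow, Real.sq_sqrt (by norm_num)]
  norm_num

theorem holeRadius_pos : 0 < holeRadius := by
  unfold holeRadius
  positivity

theorem holeRadius_lt_one : holeRadius < 1 := by
  nlinarith [holeRadius_sq, holeRadius_pos]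

theorem polar_sq (r t : ℝ) : (r * Real.cos t) ^ 2 + (r * Real.sin t) ^ 2 = r ^ 2 := by
  rw [mul_pow, mul_pow, ← mul_add, Real.cos_sq_add_sin_sq, mul_one]

theorem holeHeight_polar (b : Bool) {r : ℝ} (t : ℝ) (hr : r ^ 2 ≤ 1) :
    holeHeight (torusCover (holeLift b (r * Real.cos t) (r * Real.sin t))) =
      1 - (2 - 2 * r ^ 2) ^ 2 := by
  obtain ⟨hu, hv⟩ := abs_le_one_of_sq (polar_sq r t) hr
  rw [holeHeight_holeLift b hu hv, polar_sq]

/-- A collar of a boundary component, in polar coordinates. -/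
def holeCollar (b : Bool) : C(Set.Icc holeRadius 1 × ℝ, twoHoledTorus) where
  toFun p := ⟨torusCover (holeLift b (p.1.1 * Real.cos p.2) (p.1.1 * Real.sin p.2)), by
    obtain ⟨⟨r, h1, h2⟩, t⟩ := p
    have h3 : r ^ 2 ≤ 1 := by nlinarith [holeRadius_pos]
    have h4 : 1 / 2 ≤ r ^ 2 := by nlinarith [holeRadius_pos, holeRadius_sq]
    rw [mem_twoHoledTorus, holeHeight_polar b t h3]
    nlinarith⟩
  continuous_toFun := by
    refine Continuous.subtype_mk (torusCover.continuous.comp ?_) _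
    exact (continuous_holeLift b).comp (g := fun p : ℝ × ℝ => holeLift b p.1 p.2)
      (f := fun p : Set.Icc holeRadius 1 × ℝ => (p.1.1 * Real.cos p.2, p.1.1 * Real.sin p.2))
      (by fun_prop)

theorem circle_sq (s : Circle) : (s : ℂ).re ^ 2 + (s : ℂ).im ^ 2 = 1 := by
  have := Circle.normSq_coe s
  rw [Complex.normSq_apply] at this
  linarith

theorem circle_polar_sq (s : Circle) :
    (holeRadius * (s : ℂ).re) ^ 2 + (holeRadius * (s : ℂ).im) ^ 2 = holeRadius ^ 2 := by
  rw [mul_pow, mul_pow, ← mul_add, circle_sq, mul_one]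

/-- The parametrized boundary components of the two-holed torus. -/
def holeCircle (b : Bool) : C(Circle, twoHoledTorus) where
  toFun s := ⟨torusCover (holeLift b (holeRadius * (s : ℂ).re) (holeRadius * (s : ℂ).im)), by
    obtain ⟨hu, hv⟩ := abs_le_one_of_sq (circle_polar_sq s) (by rw [holeRadius_sq]; norm_num)
    rw [mem_twoHoledTorus, holeHeight_holeLift b hu hv, circle_polar_sq, holeRadius_sq]
    norm_num⟩
  continuous_toFun := by
    refine Continuous.subtype_mk (torusCover.continuous.comp ?_) _
    exact (continuous_holeLift b).comp (g := fun p : ℝ × ℝ => holeLift b p.1 p.2)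
      (f := fun s : Circle => (holeRadius * (s : ℂ).re, holeRadius * (s : ℂ).im)) (by fun_prop)

theorem holeCircle_coe (b : Bool) (s : Circle) : (holeCircle b s).1 =
    torusCover (holeLift b (holeRadius * (s : ℂ).re) (holeRadius * (s : ℂ).im)) := rfl

theorem holeCircle_exp_coe (b : Bool) (t : ℝ) : (holeCircle b (Circle.exp t)).1 =
    torusCover (holeLift b (holeRadius * Real.cos t) (holeRadius * Real.sin t)) := by
  rw [holeCircle_coe]
  simp [Circle.coe_exp, Complex.exp_ofReal_mul_I_re, Complex.exp_ofReal_mul_I_im]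

theorem holeCircle_exp (b : Bool) (t : ℝ) : holeCircle b (Circle.exp t) =
    holeCollar b (⟨holeRadius, le_rfl, holeRadius_lt_one.le⟩, t) :=
  Subtype.ext (holeCircle_exp_coe b t)

/-- The sign of `cos x₀ + cos x₁` selects the hole, and the polar coordinates of the half-angle
sines give the point of its collar. -/
theorem holeCollar_surjective (p : twoHoledTorus) : ∃ b x, holeCollar b x = p := by
  obtain ⟨x, hx⟩ := torusCover_surjective p.1
  have hh := mem_twoHoledTorus.1 p.2
  rw [← hx, holeHeight_torusCover, sub_nonneg, sq_le_one_iff_abs_le_one, abs_le] at hh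
  obtain ⟨b, hb⟩ : ∃ b : Bool,
      0 ≤ (if b then (1 : ℝ) else -1) * (Real.cos (x 0) + Real.cos (x 1)) := by
    rcases le_total 0 (Real.cos (x 0) + Real.cos (x 1)) with h | h
    · exact ⟨true, by simpa using h⟩
    · exact ⟨false, by simp; linarith⟩
  -- The angle measured from the centre of the hole, normalized to `[-π, π]` so that `arcsin`
  -- inverts the sine of its half.
  have hrep (y : ℝ) : ∃ θ, Circle.exp (holeCenter b + θ) = Circle.exp y ∧ -Real.pi ≤ θ ∧
      θ ≤ Real.pi ∧ Real.cos θ = (if b then 1 else -1) * Real.cos y := by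
    have h1 : Circle.exp (Circle.exp (y - holeCenter b) : ℂ).arg = Circle.exp (y - holeCenter b) :=
      Circle.exp_arg _
    refine ⟨(Circle.exp (y - holeCenter b) : ℂ).arg, ?_, (Complex.neg_pi_lt_arg _).le,
      Complex.arg_le_pi _, ?_⟩
    · rw [Circle.exp_add, h1, ← Circle.exp_add, add_sub_cancel]
    · have h2 := congrArg (fun z : Circle => (z : ℂ).re) h1
      simp only [Circle.coe_exp, Complex.exp_ofReal_mul_I_re] at h2
      rw [Circle.coe_exp, h2]
      cases b <;> simp [holeCenter, Real.cos_sub_pi]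
  obtain ⟨θ, hθ, hθ1, hθ2, hθ3⟩ := hrep (x 0)
  obtain ⟨φ, hφ, hφ1, hφ2, hφ3⟩ := hrep (x 1)
  let z : ℂ := ⟨Real.sin (θ / 2), -Real.sin (φ / 2)⟩
  have hz : ‖z‖ ^ 2 = Real.sin (θ / 2) ^ 2 + Real.sin (φ / 2) ^ 2 := by
    rw [← Complex.normSq_eq_norm_sq, Complex.normSq_apply]
    simp only [z]
    ring
  have hc (y : ℝ) : Real.cos y = 1 - 2 * Real.sin (y / 2) ^ 2 := by
    have := Real.cos_two_mul (y / 2)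
    rw [Real.cos_sq', mul_div_cancel₀ _ (two_ne_zero)] at this
    linarith
  have hz' : ‖z‖ ^ 2 = 1 - ((if b then 1 else -1) * (Real.cos (x 0) + Real.cos (x 1))) / 2 := by
    rw [mul_add, ← hθ3, ← hφ3, hc θ, hc φ, hz]
    ring
  have hz1 : ‖z‖ ≤ 1 := by
    nlinarith [norm_nonneg z]
  have hz2 : holeRadius ≤ ‖z‖ := by
    have : (if b then (1 : ℝ) else -1) * (Real.cos (x 0) + Real.cos (x 1)) ≤ 1 := by
      cases b <;> simp <;> linarith
    nlinarith [norm_nonneg z, holeRadius_sq, holeRadius_pos]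
  refine ⟨b, (⟨‖z‖, hz2, hz1⟩, z.arg), Subtype.ext ?_⟩
  change torusCover (holeLift b (‖z‖ * Real.cos z.arg) (‖z‖ * Real.sin z.arg)) = p.1
  rw [Complex.norm_mul_cos_arg, Complex.norm_mul_sin_arg, ← hx]
  have hs (y : ℝ) (h1 : -Real.pi ≤ y) (h2 : y ≤ Real.pi) :
      2 * Real.arcsin (Real.sin (y / 2)) = y := by
    rw [Real.arcsin_sin (by linarith) (by linarith)]
    ring
  rw [torusCover_apply, torusCover_apply]
  refine Prod.ext ?_ ?_
  · simp only [holeLift, z]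
    simp [hs θ hθ1 hθ2, hθ]
  · simp only [holeLift, z, Real.arcsin_neg]
    simp [hs φ hφ1 hφ2, hφ]

theorem range_holeCircle : Set.range (fun p : Bool × Circle => holeCircle p.1 p.2) =
    (𝓡∂ 2).boundary twoHoledTorus := by
  ext p
  rw [mem_boundary_twoHoledTorus]
  constructor
  · rintro ⟨⟨b, s⟩, rfl⟩
    obtain ⟨t, rfl⟩ := Circle.exp_surjective s
    rw [holeCircle_exp_coe, holeHeight_polar b t (by rw [holeRadius_sq]; norm_num), holeRadius_sq]
    norm_num
  · intro h
    obtain ⟨b, ⟨⟨r, h1, h2⟩, t⟩, rfl⟩ := holeCollar_surjective p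
    change holeHeight (torusCover (holeLift b (r * Real.cos t) (r * Real.sin t))) = 0 at h
    have h3 : r ^ 2 ≤ 1 := by nlinarith [holeRadius_pos]
    have h4 : 1 / 2 ≤ r ^ 2 := by nlinarith [holeRadius_pos, holeRadius_sq]
    rw [holeHeight_polar b t h3] at h
    have h5 : r ^ 2 = 1 / 2 := by nlinarith
    have h6 : r = holeRadius := by
      rw [← holeRadius_sq] at h5
      exact (pow_left_inj₀ (holeRadius_pos.le.trans h1) holeRadius_pos.le two_ne_zero).1 h5
    refine ⟨(b, Circle.exp t), ?_⟩
    change holeCircle b (Circle.exp t) = _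
    rw [holeCircle_exp]
    congr
    exact h6.symm

theorem abs_lt_one_of_polar (s : Circle) :
    |holeRadius * (s : ℂ).re| < 1 ∧ |holeRadius * (s : ℂ).im| < 1 := by
  rw [← sq_lt_one_iff_abs_lt_one, ← sq_lt_one_iff_abs_lt_one]
  have h1 := circle_polar_sq s
  rw [holeRadius_sq] at h1
  constructor <;> nlinarith [sq_nonneg (holeRadius * (s : ℂ).re),
    sq_nonneg (holeRadius * (s : ℂ).im)]

/-- The two circles are told apart by `cos x₀ + cos x₁ = ±1`. On one circle `|u|, |v| < 1`, so the
angles `2 arcsin u`, `2 arcsin v` stay in `(-π, π)`, where `Circle.exp` is injective. -/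
theorem holeCircle_injective :
    Function.Injective fun p : Bool × Circle => holeCircle p.1 p.2 := by
  rintro ⟨b, s⟩ ⟨b', s'⟩ h
  have h := congrArg Subtype.val h
  simp only [holeCircle_coe] at h
  have hab (s : Circle) : |holeRadius * (s : ℂ).re| ≤ 1 ∧ |holeRadius * (s : ℂ).im| ≤ 1 :=
    abs_le_one_of_sq (circle_polar_sq s) (by rw [holeRadius_sq]; norm_num)
  have hb : b = b' := by
    have h1 := congrArg (fun p : T2 => (p.1 : ℂ).re + (p.2 : ℂ).re) h
    simp only [torusCover_apply, Circle.coe_exp, Complex.exp_ofReal_mul_I_re] at h1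
    rw [cos_add_cos_holeLift b (hab s).1 (hab s).2, cos_add_cos_holeLift b' (hab s').1 (hab s').2,
      circle_polar_sq, circle_polar_sq, holeRadius_sq] at h1
    cases b <;> cases b' <;> norm_num at h1 <;> rfl
  subst hb
  have hi {u v : ℝ} (hu : |u| < 1) (hv : |v| < 1)
      (he : Circle.exp (2 * Real.arcsin u) = Circle.exp (2 * Real.arcsin v)) : u = v := by
    have hr (w : ℝ) (hw : |w| < 1) :
        -Real.pi < 2 * Real.arcsin w ∧ 2 * Real.arcsin w ≤ Real.pi := by
      have h1 := Real.neg_pi_div_two_lt_arcsin.2 (neg_lt_of_abs_lt hw)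
      have h2 := Real.arcsin_le_pi_div_two w
      constructor <;> linarith
    have h1 := congrArg (fun z : Circle => (z : ℂ).arg) he
    simp only [Circle.arg_exp (hr u hu).1 (hr u hu).2,
      Circle.arg_exp (hr v hv).1 (hr v hv).2] at h1
    have h2 : Real.arcsin u = Real.arcsin v := by linarith
    have h3 := congrArg Real.sin h2
    rwa [Real.sin_arcsin (neg_le_of_abs_le hu.le) (le_of_abs_le hu.le),
      Real.sin_arcsin (neg_le_of_abs_le hv.le) (le_of_abs_le hv.le)] at h3
  have hlt := abs_lt_one_of_polar
  have e0 : Circle.exp (holeCenter b + 2 * Real.arcsin (holeRadius * (s : ℂ).re)) =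
    Circle.exp (holeCenter b + 2 * Real.arcsin (holeRadius * (s' : ℂ).re)) := congrArg Prod.fst h
  have e1 : Circle.exp (holeCenter b - 2 * Real.arcsin (holeRadius * (s : ℂ).im)) =
    Circle.exp (holeCenter b - 2 * Real.arcsin (holeRadius * (s' : ℂ).im)) := congrArg Prod.snd h
  rw [Circle.exp_add, Circle.exp_add, mul_right_inj] at e0
  rw [Circle.exp_sub, Circle.exp_sub, div_right_inj] at e1
  have f0 := mul_left_cancel₀ holeRadius_pos.ne' (hi (hlt s).1 (hlt s').1 e0)
  have f1 := mul_left_cancel₀ holeRadius_pos.ne' (hi (hlt s).2 (hlt s').2 e1)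
  exact Prod.ext rfl (Circle.ext (Complex.ext f0 f1))

theorem contDiffAt_holeLift (b : Bool) {p : ℝ × ℝ} (h1 : |p.1| < 1) (h2 : |p.2| < 1) :
    ContDiffAt ℝ ∞ (fun p : ℝ × ℝ => holeLift b p.1 p.2) p := by
  have ha {u : ℝ} (hu : |u| < 1) : ContDiffAt ℝ ∞ Real.arcsin u :=
    Real.contDiffAt_arcsin (neg_lt_of_abs_lt hu).ne' (lt_of_abs_lt hu).ne
  rw [contDiffAt_euclidean]
  intro i
  fin_cases i
  · exact contDiffAt_const.add (contDiffAt_const.mul ((ha h1).comp p contDiffAt_fst))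
  · exact contDiffAt_const.sub (contDiffAt_const.mul ((ha h2).comp p contDiffAt_snd))

theorem contMDiff_holeCircle (b : Bool) : ContMDiff (𝓡 1) (𝓡∂ 2) ∞ (holeCircle b) := by
  intro s
  rw [contMDiffAt_iff_target]
  refine ⟨(holeCircle b).continuous.continuousAt, ?_⟩
  obtain ⟨e, he, hp, hc⟩ := chartAt_twoHoledTorus (holeCircle b s)
  let P : Circle → ℝ × ℝ := fun s => (holeRadius * (s : ℂ).re, holeRadius * (s : ℂ).im)
  have hP : ContMDiff (𝓡 1) 𝓘(ℝ, ℝ × ℝ) ∞ P := by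
    have h1 : ContMDiff (𝓡 1) 𝓘(ℝ, ℂ) ∞ (fun s : Circle => (s : ℂ)) := by
      have : Fact (Module.finrank ℝ ℂ = 1 + 1) := finrank_real_complex_fact'
      exact contMDiff_coe_sphere
    have h2 : ContDiff ℝ ∞ (fun z : ℂ => (holeRadius * z.re, holeRadius * z.im)) :=
      (contDiff_const.mul Complex.reCLM.contDiff).prodMk (contDiff_const.mul Complex.imCLM.contDiff)
    exact h2.contMDiff.comp h1
  have hs : torusCover (holeLift b (P s).1 (P s).2) ∈ e.source := hp
  have h3 : ContDiffAt ℝ ∞ ((e ∘ torusCover) ∘ fun p : ℝ × ℝ => holeLift b p.1 p.2) (P s) :=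
    (he.oriented _ hs).1.comp (P s)
      (contDiffAt_holeLift b (abs_lt_one_of_polar s).1 (abs_lt_one_of_polar s).2)
  refine (h3.contMDiffAt.comp s hP.contMDiffAt).congr_of_eventuallyEq ?_
  have hnear : ∀ᶠ s' in nhds s, (holeCircle b s').1 ∈ e.source :=
    (continuous_subtype_val.comp (holeCircle b).continuous).continuousAt
      (e.open_source.mem_nhds hp)
  filter_upwards [hnear] with s' hs'
  rw [Function.comp_apply, extChartAt, hc]
  exact holedChart_apply he hs'

theorem hasDerivAt_E2 {f g : ℝ → ℝ} {f' g' t : ℝ} (hf : HasDerivAt f f' t)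
    (hg : HasDerivAt g g' t) : HasDerivAt (fun t => (!₂[f t, g t] : E2)) !₂[f', g'] t := by
  have h : HasDerivAt (fun t => ![f t, g t]) ![f', g'] t := by
    rw [hasDerivAt_pi]
    intro i
    fin_cases i
    · exact hf
    · exact hg
  exact ((EuclideanSpace.equiv (Fin 2) ℝ).symm.hasFDerivAt.comp_hasDerivAt t h)

/-- Let `T` be the velocity of the circle and `N` the radial vector, pointing away from the hole and
so into the surface. The chart kills the height component of `T` and makes that of `N` positive. The
pair `(N, T)` is negatively oriented, owing to the minus sign in `holeLift`, and the chart preserves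
orientation, so the other component of `T` is negative. -/
theorem holeCircle_deriv_neg (b : Bool)
    {c : OpenPartialHomeomorph twoHoledTorus (EuclideanHalfSpace 2)} (hc : c ∈ holedAtlas) {t : ℝ}
    (ht : holeCircle b (Circle.exp t) ∈ c.source) :
    deriv (fun t : ℝ => (c (holeCircle b (Circle.exp t))).1 1) t < 0 := by
  obtain ⟨e, he, rfl⟩ := hc
  have hsrc : torusCover (holeLift b (holeRadius * Real.cos t) (holeRadius * Real.sin t)) ∈
      e.source := by
    rw [← holeCircle_exp_coe]
    exact ht
  set x := holeLift b (holeRadius * Real.cos t) (holeRadius * Real.sin t) with hx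
  obtain ⟨hsm, hdet⟩ := he.oriented x hsrc
  set D := fderiv ℝ (e ∘ torusCover) x with hD
  have hDx : HasFDerivAt (e ∘ torusCover) D x := (hsm.differentiableAt (by simp)).hasFDerivAt
  have hheight : ∀ p ∈ e.source, e p 0 = holeHeight p := by
    rcases he.height with h | h
    · exact h
    · exfalso
      have := (h _ hsrc).1
      rw [hx, holeHeight_polar b t (by rw [holeRadius_sq]; norm_num), holeRadius_sq] at this
      norm_num at this
  have hlt := abs_lt_one_of_polar (Circle.exp t)
  simp only [Circle.coe_exp, Complex.exp_ofReal_mul_I_re, Complex.exp_ofReal_mul_I_im] at hlt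
  obtain ⟨hu, hv⟩ := hlt
  set α := 1 / √(1 - (holeRadius * Real.cos t) ^ 2) with hα
  set β := 1 / √(1 - (holeRadius * Real.sin t) ^ 2) with hβ
  have hα0 : 0 < α := by
    rw [hα]
    have := sq_lt_one_iff_abs_lt_one _ |>.2 hu
    have := Real.sqrt_pos.2 (sub_pos.2 this)
    positivity
  have hβ0 : 0 < β := by
    rw [hβ]
    have := sq_lt_one_iff_abs_lt_one _ |>.2 hv
    have := Real.sqrt_pos.2 (sub_pos.2 this)
    positivity
  have hau := Real.hasDerivAt_arcsin (neg_lt_of_abs_lt hu).ne' (lt_of_abs_lt hu).ne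
  have hav := Real.hasDerivAt_arcsin (neg_lt_of_abs_lt hv).ne' (lt_of_abs_lt hv).ne
  let T : E2 := !₂[2 * (α * (holeRadius * -Real.sin t)), -(2 * (β * (holeRadius * Real.cos t)))]
  let N : E2 := !₂[2 * (α * Real.cos t), -(2 * (β * Real.sin t))]
  have hT : HasDerivAt (fun t => holeLift b (holeRadius * Real.cos t) (holeRadius * Real.sin t))
      T t :=
    hasDerivAt_E2
      (((hau.comp t ((Real.hasDerivAt_cos t).const_mul holeRadius)).const_mul 2).const_add _)
      (((hav.comp t ((Real.hasDerivAt_sin t).const_mul holeRadius)).const_mul 2).const_sub _)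
  have hN : HasDerivAt (fun r => holeLift b (r * Real.cos t) (r * Real.sin t)) N holeRadius := by
    have h1 (k : ℝ) : HasDerivAt (fun r : ℝ => r * k) k holeRadius := hasDerivAt_mul_const k
    exact hasDerivAt_E2
      (((hau.comp holeRadius (h1 (Real.cos t))).const_mul 2).const_add _)
      (((hav.comp holeRadius (h1 (Real.sin t))).const_mul 2).const_sub _)
  have hET := hDx.comp_hasDerivAt t hT
  have hEN := hDx.comp_hasDerivAt holeRadius hN
  have hproj (i : Fin 2) {φ : ℝ → E2} {v : E2} {r : ℝ} (h : HasDerivAt φ v r) :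
      HasDerivAt (fun r => φ r i) (v i) r :=
    (EuclideanSpace.proj i : E2 →L[ℝ] ℝ).hasFDerivAt.comp_hasDerivAt r h
  have hnear : ∀ᶠ t' in nhds t, torusCover
      (holeLift b (holeRadius * Real.cos t') (holeRadius * Real.sin t')) ∈ e.source :=
    (torusCover.continuous.continuousAt.comp hT.continuousAt) (e.open_source.mem_nhds hsrc)
  have hnear' : ∀ᶠ r in nhds holeRadius, torusCover
      (holeLift b (r * Real.cos t) (r * Real.sin t)) ∈ e.source :=
    (torusCover.continuous.continuousAt.comp hN.continuousAt) (e.open_source.mem_nhds hsrc)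
  have hT0 : D T 0 = 0 := by
    refine (hproj 0 hET).unique ((hasDerivAt_const t (0 : ℝ)).congr_of_eventuallyEq ?_)
    filter_upwards [hnear] with t' ht'
    rw [Function.comp_apply, Function.comp_apply, hheight _ ht',
      holeHeight_polar b t' (by rw [holeRadius_sq]; norm_num), holeRadius_sq]
    norm_num
  -- The derivative of `1 - (2 - 2r²)²` is `8r (2 - 2r²)`, and `2 - 2r² = 1` at the radius of the
  -- hole.
  have hN0 : D N 0 = 4 * holeRadius * 2 := by
    have h1 : HasDerivAt (fun r : ℝ => 1 - (2 - 2 * r ^ 2) ^ 2) (4 * holeRadius * 2)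
        holeRadius := by
      have := ((((hasDerivAt_id holeRadius).pow 2).const_mul 2).const_sub 2).pow 2 |>.const_sub 1
      refine HasDerivAt.congr_deriv this ?_
      simp only [Pi.pow_apply, id, holeRadius_sq]
      norm_num
      ring
    refine (hproj 0 hEN).unique (h1.congr_of_eventuallyEq ?_)
    have hlt1 : ∀ᶠ r in nhds holeRadius, r ^ 2 < 1 :=
      (continuous_pow 2).continuousAt.eventually_lt_const
        (show holeRadius ^ 2 < 1 by rw [holeRadius_sq]; norm_num)
    filter_upwards [hnear', hlt1] with r hr hr1
    rw [Function.comp_apply, Function.comp_apply, hheight _ hr, holeHeight_polar b t hr1.le]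
  have hder : deriv (fun t : ℝ => (holedChart e he (holeCircle b (Circle.exp t))).1 1) t =
      D T 1 := by
    refine ((hproj 1 hET).congr_of_eventuallyEq ?_).deriv
    filter_upwards [hnear] with t' ht'
    rw [← holeCircle_exp_coe] at ht'
    rw [holedChart_apply he ht', Function.comp_apply, Function.comp_apply, holeCircle_exp_coe]
  rw [hder]
  have key := det_E2_mul D N T
  rw [hT0, hN0, zero_mul, sub_zero] at key
  have harea : N 0 * T 1 - T 0 * N 1 = -(4 * α * β * holeRadius) := by
    simp only [N, T]
    simp
    linear_combination (-4 * α * β * holeRadius) * Real.cos_sq_add_sin_sq t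
  rw [harea] at key
  have hpos := mul_pos hdet (mul_pos (mul_pos (mul_pos four_pos hα0) hβ0) holeRadius_pos)
  have hr := holeRadius_pos
  by_contra! h
  nlinarith [mul_nonneg (mul_pos (mul_pos four_pos hr) two_pos).le h]

/-! ### Topology of the two-holed torus -/

/-- For `c, s ≥ 0` the arcsines are complementary. For `c, s ≤ 0` the sum of the doubled arcsines is
`-π`, the same point of the circle. -/
theorem exp_two_arcsin_add {c s : ℝ} (h : c ^ 2 + s ^ 2 = 1) (hcs : 0 ≤ c * s) :
    Circle.exp (2 * Real.arcsin c) * Circle.exp (2 * Real.arcsin s) = Circle.exp Real.pi := by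
  have key {c s : ℝ} (h : c ^ 2 + s ^ 2 = 1) (hc : 0 ≤ c) (hs : 0 ≤ s) :
      2 * Real.arcsin c + 2 * Real.arcsin s = Real.pi := by
    have : Real.arcsin c = Real.arccos s := by
      rw [Real.arcsin_eq_arccos hc, ← h, add_sub_cancel_left, Real.sqrt_sq hs]
    rw [this, Real.arcsin_eq_pi_div_two_sub_arccos]
    ring
  rw [← Circle.exp_add]
  rcases mul_nonneg_iff.1 hcs with ⟨hc, hs⟩ | ⟨hc, hs⟩
  · rw [key h hc hs]
  · have := key (c := -c) (s := -s) (by linarith) (by linarith) (by linarith)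
    rw [Real.arcsin_neg, Real.arcsin_neg] at this
    rw [show 2 * Real.arcsin c + 2 * Real.arcsin s = -Real.pi by linarith]
    exact Circle.exp_eq_exp.2 ⟨-1, by push_cast; ring⟩

/-- The outer edge of a collar. -/
def outerEdge (b : Bool) (t : ℝ) : twoHoledTorus :=
  holeCollar b (⟨1, holeRadius_lt_one.le, le_rfl⟩, t)

theorem outerEdge_coe (b : Bool) (t : ℝ) : (outerEdge b t).1 =
    (Circle.exp (holeCenter b) * Circle.exp (2 * Real.arcsin (Real.cos t)),
      Circle.exp (holeCenter b) * (Circle.exp (2 * Real.arcsin (Real.sin t)))⁻¹) := by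
  change torusCover (holeLift b (1 * Real.cos t) (1 * Real.sin t)) = _
  rw [one_mul, one_mul, torusCover_apply]
  refine Prod.ext ?_ ?_
  · simp [holeLift, Circle.exp_add]
  · simp [holeLift, Circle.exp_sub, div_eq_mul_inv]

/-- Both outer edges run along `cos x₀ + cos x₁ = 0`. The change of parameter between them is a
reflection of the angle, whose axis depends on the quadrant. -/
theorem outerEdge_false {t t' : ℝ} (h : (0 ≤ Real.cos t * Real.sin t ∧
    Real.cos t' = -Real.sin t ∧ Real.sin t' = -Real.cos t) ∨
    (Real.cos t * Real.sin t ≤ 0 ∧ Real.cos t' = Real.sin t ∧ Real.sin t' = Real.cos t)) :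
    outerEdge false t = outerEdge true t' := by
  have hpi : Circle.exp Real.pi * Circle.exp Real.pi = 1 := by
    rw [← Circle.exp_add]
    exact Circle.exp_eq_one.2 ⟨1, by push_cast; ring⟩
  have hpi' : (Circle.exp Real.pi)⁻¹ = Circle.exp Real.pi := inv_eq_of_mul_eq_one_left hpi
  apply Subtype.ext
  rw [outerEdge_coe, outerEdge_coe]
  simp only [holeCenter, if_true, Circle.exp_zero, one_mul, Bool.false_eq_true, if_false]
  rcases h with ⟨h, h1, h2⟩ | ⟨h, h1, h2⟩
  · have k := exp_two_arcsin_add (Real.cos_sq_add_sin_sq t) h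
    rw [h1, h2, Real.arcsin_neg, Real.arcsin_neg, mul_neg, mul_neg, Circle.exp_neg, Circle.exp_neg,
      inv_inv]
    refine Prod.ext ?_ ?_
    · change Circle.exp Real.pi * _ = _
      rw [← hpi', ← k, mul_inv_rev, inv_mul_cancel_right]
    · change Circle.exp Real.pi * _ = _
      rw [← k, mul_inv_cancel_right]
  · have k := exp_two_arcsin_add (c := Real.cos t) (s := -Real.sin t)
      (by rw [neg_sq, Real.cos_sq_add_sin_sq]) (by linarith)
    rw [Real.arcsin_neg, mul_neg, Circle.exp_neg] at k
    rw [h1, h2]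
    refine Prod.ext ?_ ?_
    · change Circle.exp Real.pi * _ = _
      rw [← hpi', ← k, mul_inv_rev, inv_inv, inv_mul_cancel_right]
    · change Circle.exp Real.pi * _ = _
      rw [← hpi', ← k, mul_inv_rev, inv_inv, mul_right_comm, mul_inv_cancel, one_mul]

instance (a b : ℝ) [Fact (a ≤ b)] : ContractibleSpace (Set.Icc a b) :=
  (convex_Icc a b).contractibleSpace ⟨a, le_rfl, Fact.out⟩

instance : Fact (holeRadius ≤ 1) := ⟨holeRadius_lt_one.le⟩

/-- Each boundary circle is homotopic through its collar to the outer edge. The two outer edges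
traverse the same four arcs, each in opposite directions, so the turnings of `f` cancel. -/
theorem winding_holeCircle_add (f : C(twoHoledTorus, Circle)) :
    winding f (loopClass (holeCircle true)) + winding f (loopClass (holeCircle false)) = 0 := by
  have hF (b : Bool) := Circle.exists_lift (f.comp (holeCollar b))
  choose F hF using hF
  have hper (b : Bool) (r : Set.Icc holeRadius 1) :
      holeCollar b (r, 2 * Real.pi) = holeCollar b (r, 0) := by
    apply Subtype.ext
    change torusCover (holeLift _ _ _) = torusCover (holeLift _ _ _)
    simp
  let r₀ : Set.Icc holeRadius 1 := ⟨holeRadius, le_rfl, holeRadius_lt_one.le⟩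
  let r₁ : Set.Icc holeRadius 1 := ⟨1, holeRadius_lt_one.le, le_rfl⟩
  have hw (b : Bool) : winding f (loopClass (holeCircle b)) =
      (F b (r₁, 2 * Real.pi) - F b (r₁, 0)) / (2 * Real.pi) := by
    rw [winding_loopClass f (holeCircle b) (F := fun t => F b (r₀, t)) (by fun_prop)
      (fun t => (hF b _).trans (by rw [holeCircle_exp]; rfl))]
    have := Circle.lift_sub_eq (F := fun r => F b (r, 2 * Real.pi)) (G := fun r => F b (r, 0))
      (by fun_prop) (by fun_prop) (fun r => by
        rw [hF, hF, ContinuousMap.comp_apply, hper]; rfl) r₀ r₁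
    congr 1
    linarith
  -- On an arc where the edges correspond under `t ↦ C - t`, both lifts cover the same path, so
  -- their increments agree. The constant `C` is `3π/2` or `5π/2` according to the quadrant, chosen
  -- so that the arcs fill `[0, 2π]` on both sides.
  have hquarter {a b : ℝ} (hab : a ≤ b) (C : ℝ)
      (h : ∀ t ∈ Set.Icc a b, outerEdge false t = outerEdge true (C - t)) :
      F false (r₁, b) - F false (r₁, a) = F true (r₁, C - b) - F true (r₁, C - a) := by
    have : Fact (a ≤ b) := ⟨hab⟩
    exact Circle.lift_sub_eq (A := Set.Icc a b) (F := fun t => F false (r₁, t.1))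
      (G := fun t => F true (r₁, C - t.1)) (by fun_prop) (by fun_prop)
      (fun t => (hF _ _).trans ((congrArg f (h t.1 t.2)).trans (hF _ _).symm))
      ⟨b, hab, le_rfl⟩ ⟨a, le_rfl, hab⟩
  have hpi := Real.pi_pos
  have hc1 (t : ℝ) : Real.cos (3 * Real.pi / 2 - t) = -Real.sin t := by
    rw [show 3 * Real.pi / 2 - t = Real.pi + (Real.pi / 2 - t) by ring, add_comm, Real.cos_add_pi,
      Real.cos_pi_div_two_sub]
  have hs1 (t : ℝ) : Real.sin (3 * Real.pi / 2 - t) = -Real.cos t := by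
    rw [show 3 * Real.pi / 2 - t = Real.pi + (Real.pi / 2 - t) by ring, add_comm, Real.sin_add_pi,
      Real.sin_pi_div_two_sub]
  have hc2 (t : ℝ) : Real.cos (5 * Real.pi / 2 - t) = Real.sin t := by
    rw [show 5 * Real.pi / 2 - t = (Real.pi / 2 - t) + 2 * Real.pi by ring, Real.cos_add_two_pi,
      Real.cos_pi_div_two_sub]
  have hs2 (t : ℝ) : Real.sin (5 * Real.pi / 2 - t) = Real.cos t := by
    rw [show 5 * Real.pi / 2 - t = (Real.pi / 2 - t) + 2 * Real.pi by ring, Real.sin_add_two_pi,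
      Real.sin_pi_div_two_sub]
  have q1 := hquarter (a := 0) (b := Real.pi / 2) (by linarith) (3 * Real.pi / 2) fun t ht =>
    outerEdge_false (.inl ⟨mul_nonneg
      (Real.cos_nonneg_of_neg_pi_div_two_le_of_le (by linarith [ht.1]) ht.2)
      (Real.sin_nonneg_of_nonneg_of_le_pi ht.1 (by linarith [ht.2])), hc1 t, hs1 t⟩)
  have q2 := hquarter (a := Real.pi / 2) (b := Real.pi) (by linarith) (5 * Real.pi / 2) fun t ht =>
    outerEdge_false (.inr ⟨mul_nonpos_of_nonpos_of_nonneg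
      (Real.cos_nonpos_of_pi_div_two_le_of_le ht.1 (by linarith [ht.2]))
      (Real.sin_nonneg_of_nonneg_of_le_pi (by linarith [ht.1]) ht.2), hc2 t, hs2 t⟩)
  have hsn {t : ℝ} (h1 : Real.pi ≤ t) (h2 : t ≤ 2 * Real.pi) : Real.sin t ≤ 0 := by
    rw [← Real.sin_sub_two_pi]
    exact Real.sin_nonpos_of_nonpos_of_neg_pi_le (by linarith) (by linarith)
  have q3 := hquarter (a := Real.pi) (b := 3 * Real.pi / 2) (by linarith) (3 * Real.pi / 2)
    fun t ht => outerEdge_false (.inl ⟨mul_nonneg_of_nonpos_of_nonpos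
      (Real.cos_nonpos_of_pi_div_two_le_of_le (by linarith [ht.1]) (by linarith [ht.2]))
      (hsn ht.1 (by linarith [ht.2])), hc1 t, hs1 t⟩)
  have q4 := hquarter (a := 3 * Real.pi / 2) (b := 2 * Real.pi) (by linarith) (5 * Real.pi / 2)
    fun t ht => outerEdge_false (.inr ⟨mul_nonpos_of_nonneg_of_nonpos
      (by
        rw [← Real.cos_sub_two_pi]
        exact Real.cos_nonneg_of_neg_pi_div_two_le_of_le (by linarith [ht.1]) (by linarith [ht.2]))
      (hsn (by linarith [ht.1]) ht.2), hc2 t, hs2 t⟩)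
  rw [show 3 * Real.pi / 2 - Real.pi / 2 = Real.pi by ring, sub_zero] at q1
  rw [show 5 * Real.pi / 2 - Real.pi = 3 * Real.pi / 2 by ring,
    show 5 * Real.pi / 2 - Real.pi / 2 = 2 * Real.pi by ring] at q2
  rw [show 3 * Real.pi / 2 - 3 * Real.pi / 2 = 0 by ring,
    show 3 * Real.pi / 2 - Real.pi = Real.pi / 2 by ring] at q3
  rw [show 5 * Real.pi / 2 - 2 * Real.pi = Real.pi / 2 by ring,
    show 5 * Real.pi / 2 - 3 * Real.pi / 2 = Real.pi by ring] at q4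
  rw [hw, hw, ← add_div, div_eq_zero_iff]
  left
  linarith

instance : PathConnectedSpace twoHoledTorus where
  nonempty := inferInstance
  joined := by
    have h1 (b : Bool) (x : Set.Icc holeRadius 1 × ℝ) : Joined (holeCollar b x) (outerEdge b 0) :=
      (PathConnectedSpace.joined x _).map (holeCollar b).continuous
    have h2 : outerEdge false 0 = outerEdge true (Real.pi / 2) :=
      outerEdge_false (.inr (by simp))
    have h3 (p : twoHoledTorus) : Joined p (outerEdge true 0) := by
      obtain ⟨b, x, rfl⟩ := holeCollar_surjective p
      cases b
      · refine (h1 false x).trans ?_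
        rw [h2]
        exact h1 true _
      · exact h1 true x
    exact fun p q => (h3 p).trans (h3 q).symm

theorem winding_loopClass_eq_zero_of_contractible {X : Type} [TopologicalSpace X]
    [ContractibleSpace X] (f : C(X, Circle)) (γ : C(Circle, X)) : winding f (loopClass γ) = 0 := by
  obtain ⟨F, hF⟩ := Circle.exists_lift f
  rw [winding_loopClass f γ (F := fun t => F (γ (Circle.exp t))) (by fun_prop) fun t => hF _]
  simp

/-- The coordinate circles `S¹ × {i}` and `{i} × S¹` of the two-holed torus. -/
def axisCircle : Fin 2 → C(Circle, twoHoledTorus)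
  | 0 => ⟨fun s => ⟨(s, Circle.exp (Real.pi / 2)), by
      have := circle_sq s
      rw [mem_twoHoledTorus, holeHeight, Circle.coe_exp, Complex.exp_ofReal_mul_I_re,
        Real.cos_pi_div_two]
      nlinarith [sq_nonneg (s : ℂ).im]⟩, by fun_prop⟩
  | 1 => ⟨fun s => ⟨(Circle.exp (Real.pi / 2), s), by
      have := circle_sq s
      rw [mem_twoHoledTorus, holeHeight, Circle.coe_exp, Complex.exp_ofReal_mul_I_re,
        Real.cos_pi_div_two]
      nlinarith [sq_nonneg (s : ℂ).im]⟩, by fun_prop⟩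

/-- The coordinate functions of the two-holed torus. -/
def axisProj (i : Fin 2) : C(twoHoledTorus, Circle) :=
  (fiberProj i).comp ⟨Subtype.val, continuous_subtype_val⟩

theorem winding_axisCircle (i j : Fin 2) :
    winding (axisProj i) (loopClass (axisCircle j)) = if i = j then 1 else 0 := by
  fin_cases i <;> fin_cases j <;>
    first
    | exact winding_eq_one_of_comp_eq_id fun s => rfl
    | exact winding_eq_zero_of_comp_const (c := Circle.exp (Real.pi / 2)) fun s => rfl

/-- In a contractible space all winding numbers vanish, but a coordinate circle has winding number
`1`. -/
theorem twoHoledTorus_not_disk :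
    IsEmpty (twoHoledTorus ≃ₜ Metric.closedBall (0 : EuclideanSpace ℝ (Fin 2)) 1) := by
  refine ⟨fun h => ?_⟩
  have : ContractibleSpace (Metric.closedBall (0 : EuclideanSpace ℝ (Fin 2)) 1) :=
    (convex_closedBall _ _).contractibleSpace ⟨0, by simp⟩
  have := h.contractibleSpace
  have h1 := winding_axisCircle 0 0
  rw [winding_loopClass_eq_zero_of_contractible] at h1
  simp at h1

/-- The winding numbers of a map from an annulus to the circle are proportional to those of the
projection. -/
theorem exists_winding_annulus (K : C(Circle × unitInterval, Circle)) :
    ∃ d : ℝ, ∀ γ : C(Circle, Circle × unitInterval),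
      winding K (loopClass γ) = d * winding ContinuousMap.fst (loopClass γ) := by
  let P : C(ℝ × unitInterval, Circle × unitInterval) :=
    ⟨fun x => (Circle.exp x.1, x.2), by fun_prop⟩
  have : Fact ((0 : ℝ) ≤ 1) := ⟨zero_le_one⟩
  have : ContractibleSpace unitInterval := inferInstanceAs (ContractibleSpace (Set.Icc (0 : ℝ) 1))
  obtain ⟨F, hF⟩ := Circle.exists_lift (K.comp P)
  -- The increment of a lift to the strip over one period, the same at all points by uniqueness of
  -- lifts; divided by `2π` it is the required factor.
  let D : ℝ := F (0 + 2 * Real.pi, 0) - F (0, 0)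
  have hD (x : ℝ) (y : unitInterval) : F (x + 2 * Real.pi, y) = F (x, y) + D := by
    have := Circle.lift_sub_eq (A := ℝ × unitInterval) (F := fun p => F (p.1 + 2 * Real.pi, p.2))
      (G := F) (by fun_prop) F.continuous (fun p => by
        rw [hF, hF]
        simp [P]) (x, y) (0, 0)
    simp only [D]
    linarith
  have hn (n : ℤ) (x : ℝ) (y : unitInterval) : F (x + n * (2 * Real.pi), y) = F (x, y) + n * D := by
    induction n with
    | zero => simp
    | succ n ih =>
      have := hD (x + n * (2 * Real.pi)) y
      push_cast at ih ⊢
      rw [show x + ((n : ℝ) + 1) * (2 * Real.pi) = x + n * (2 * Real.pi) + 2 * Real.pi by ring,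
        this, ih]
      ring
    | pred n ih =>
      have := hD (x + (-(n : ℝ) - 1) * (2 * Real.pi)) y
      push_cast at ih ⊢
      rw [show x + (-(n : ℝ) - 1) * (2 * Real.pi) + 2 * Real.pi = x + -n * (2 * Real.pi) by ring,
        ih] at this
      linarith
  refine ⟨D / (2 * Real.pi), fun γ => ?_⟩
  obtain ⟨a, ha⟩ := Circle.exists_lift
    (A := ℝ) ((ContinuousMap.fst.comp γ).comp ⟨fun t => Circle.exp t, by fun_prop⟩)
  have ha' (t : ℝ) : Circle.exp (a t) = (γ (Circle.exp t)).1 := ha t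
  obtain ⟨n, hn'⟩ := exists_int_of_exp_eq (x := a 0) (y := a (2 * Real.pi))
    (by rw [ha', ha']; simp)
  rw [winding_loopClass ContinuousMap.fst γ a.continuous ha',
    winding_loopClass K γ (F := fun t => F (a t, (γ (Circle.exp t)).2)) (by fun_prop) (fun t => by
      rw [hF]
      simp [P, ha'])]
  have e : a (2 * Real.pi) = a 0 + n * (2 * Real.pi) := by linarith
  have := Real.pi_pos
  rw [hn', e]
  simp only [Circle.exp_two_pi, Circle.exp_zero]
  rw [hn]
  field_simp
  ring

/-- On an annulus the pairing of maps to the circle with loops has rank at most one, while two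
coordinate functions and two coordinate circles pair by the identity matrix. -/
theorem twoHoledTorus_not_annulus : IsEmpty (twoHoledTorus ≃ₜ Circle × unitInterval) := by
  refine ⟨fun h => ?_⟩
  let φ : C(twoHoledTorus, Circle × unitInterval) := ⟨h, h.continuous⟩
  let ψ : C(Circle × unitInterval, twoHoledTorus) := ⟨h.symm, h.symm.continuous⟩
  have hψφ : ψ.comp φ = ContinuousMap.id _ := by
    ext1 x
    exact h.symm_apply_apply x
  have key (i : Fin 2) : ∃ d : ℝ, ∀ j, (if i = j then (1 : ℝ) else 0) =
      d * winding ContinuousMap.fst (loopClass (φ.comp (axisCircle j))) := by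
    obtain ⟨d, hd⟩ := exists_winding_annulus ((axisProj i).comp ψ)
    refine ⟨d, fun j => ?_⟩
    rw [← hd, ← winding_axisCircle, ← winding_map, H1.map_loopClass, ← ContinuousMap.comp_assoc,
      hψφ, ContinuousMap.id_comp]
  obtain ⟨d, hd⟩ := key 0
  obtain ⟨d', hd'⟩ := key 1
  have a1 := hd 0
  have a2 := hd 1
  have a3 := hd' 0
  have a4 := hd' 1
  simp at a1 a2 a3 a4
  rcases a2 with h | h
  · rw [h] at a1
    simp at a1
  · rw [h] at a4
    simp at a4

/-- The winding numbers of the loops in a continuous family over a path connected space agree. -/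
theorem winding_family_eq {X : Type} [TopologicalSpace X] [PathConnectedSpace X]
    (K : C(X × Circle, Circle)) (x y : X) :
    winding K (loopClass ⟨fun s => (x, s), by fun_prop⟩) =
      winding K (loopClass ⟨fun s => (y, s), by fun_prop⟩) := by
  obtain ⟨p⟩ := PathConnectedSpace.joined x y
  have : Fact ((0 : ℝ) ≤ 1) := ⟨zero_le_one⟩
  have : ContractibleSpace unitInterval := inferInstanceAs (ContractibleSpace (Set.Icc (0 : ℝ) 1))
  obtain ⟨F, hF⟩ := Circle.exists_lift (A := unitInterval × ℝ)
    (K.comp ⟨fun q => (p q.1, Circle.exp q.2), by fun_prop⟩)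
  have := Circle.lift_sub_eq (F := fun r => F (r, 2 * Real.pi)) (G := fun r => F (r, 0))
    (by fun_prop) (by fun_prop) (fun r => by
      rw [hF, hF]
      simp) 0 1
  rw [winding_loopClass K _ (F := fun t => F (0, t)) (by fun_prop) (fun t => by rw [hF]; simp),
    winding_loopClass K _ (F := fun t => F (1, t)) (by fun_prop) (fun t => by rw [hF]; simp)]
  congr 1
  linarith

/-! ### Bases induced by trivializations -/

theorem winding_eq_degree {X : Type} [TopologicalSpace X] (f : C(X, Circle)) (γ : C(Circle, X)) :
    winding f (loopClass γ) = winding (ContinuousMap.id Circle) (loopClass (f.comp γ)) := by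
  rw [← H1.map_loopClass, winding_map]
  rfl

namespace BlockSystem.BlockTrivialization

variable {B : BlockSystem} {v : B.V}

/-- The coordinates of the basis that a trivialization induces on a boundary torus. -/
def coord (τ : B.BlockTrivialization v) (a : B.bd v) (j : Fin 3) : Fin 3 → ℤ :=
  torusCoord (basis (w := ⟨v, a⟩) τ j)

theorem coord_base (τ : B.BlockTrivialization v) (a : B.bd v) (j : Fin 3) :
    τ.coord a j 0 = if 0 = j then 1 else 0 := by
  rw [← torusCoord_torusBasis]
  have h := torusCoord_cast (basis (w := ⟨v, a⟩) τ j) 0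
  rw [basis, winding_map] at h
  have h' := torusCoord_cast (torusBasis j) 0
  have e : (torusProj 0).comp (onTorus (w := ⟨v, a⟩) τ) = torusProj 0 := rfl
  rw [e, ← h'] at h
  exact_mod_cast h

/-- The components of a section of a trivialization. -/
def sectionMap (τ : B.BlockTrivialization v) (i : Fin 2) : C(B.Φ v, Circle) :=
  (fiberProj i).comp ⟨fun x => (τ.toDiffeo (x, (1, 1))).2, by
    have := τ.toDiffeo.continuous
    fun_prop⟩

/-- The components of a trivialization along a coordinate circle of the fibre. -/
def fiberFamily (τ : B.BlockTrivialization v) (i j : Fin 2) : C(B.Φ v × Circle, Circle) :=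
  (fiberProj i).comp ⟨fun x => (τ.toDiffeo (x.1, fiberCircle j x.2)).2, by
    have := τ.toDiffeo.continuous
    fun_prop⟩

/-- The fibre coordinates of `z_w` are winding numbers of a map defined on the whole base; thus
relations between boundary circles become relations between the `z_w`. -/
theorem coord_section (τ : B.BlockTrivialization v) (a : B.bd v) (i : Fin 2) :
    (τ.coord a 0 i.succ : ℝ) = winding (τ.sectionMap i) (loopClass (B.circle v a)) := by
  rw [coord, torusCoord_cast, basis, winding_map, torusBasis]
  rw [winding_eq_degree, winding_eq_degree (τ.sectionMap i)]
  congr 2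
  fin_cases i <;> rfl

theorem coord_fiber (τ : B.BlockTrivialization v) (a : B.bd v) (i j : Fin 2) :
    (τ.coord a j.succ i.succ : ℝ) = winding (τ.fiberFamily i j)
      (loopClass ⟨fun s => (B.circle v a 1, s), by fun_prop⟩) := by
  rw [coord, torusCoord_cast, basis, winding_map, torusBasis]
  rw [winding_eq_degree, winding_eq_degree (τ.fiberFamily i j)]
  congr 2
  fin_cases i <;> fin_cases j <;> rfl

/-- The fibre circles form a continuous family over the path-connected base, so their classes are
the same at all boundary components. -/
theorem coord_fiber_eq [PathConnectedSpace (B.Φ v)] (τ : B.BlockTrivialization v) (a a' : B.bd v)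
    {j : Fin 3} (hj : j ≠ 0) : τ.coord a j = τ.coord a' j := by
  obtain ⟨j, rfl⟩ := Fin.exists_succ_eq.2 hj
  funext i
  rcases Fin.eq_zero_or_eq_succ i with rfl | ⟨i, rfl⟩
  · rw [coord_base, coord_base]
  · have h := τ.coord_fiber a i j
    rw [winding_family_eq _ _ (B.circle v a' 1), ← τ.coord_fiber a' i j] at h
    exact_mod_cast h

/-- The inverse diffeomorphism restricts to a left inverse on the boundary torus. It carries the
basis element back to a standard basis vector, which is divisible only by units. -/
theorem isUnit_of_coord_eq (τ : B.BlockTrivialization v) (a : B.bd v) (j : Fin 3) (m : ℤ)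
    (u : Fin 3 → ℤ) (h : τ.coord a j = m • u) : IsUnit m := by
  let σ : C(T3, T3) := ⟨fun p => (p.1, (τ.toDiffeo.symm (B.boundaryTorus ⟨v, a⟩ p)).2), by
    have := τ.toDiffeo.symm.continuous
    fun_prop⟩
  have hσ : σ.comp (onTorus (w := ⟨v, a⟩) τ) = ContinuousMap.id _ := by
    ext1 p
    have h1 : B.boundaryTorus ⟨v, a⟩ (onTorus (w := ⟨v, a⟩) τ p) =
        τ.toDiffeo (B.boundaryTorus ⟨v, a⟩ p) :=
      Prod.ext (τ.fst_eq (B.boundaryTorus ⟨v, a⟩ p)).symm rfl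
    refine Prod.ext rfl ?_
    change (τ.toDiffeo.symm (B.boundaryTorus ⟨v, a⟩ (onTorus (w := ⟨v, a⟩) τ p))).2 = p.2
    rw [h1, τ.toDiffeo.symm_apply_apply]
    rfl
  have h1 : basis (w := ⟨v, a⟩) τ j = m • torusCoord.symm u := by
    apply torusCoord.injective
    rw [map_zsmul, AddEquiv.apply_symm_apply]
    exact h
  have h2 : H1.map σ (basis (w := ⟨v, a⟩) τ j) = torusBasis j := by
    rw [basis, ← H1.map_comp, hσ, H1.map_id]
  rw [h1, map_zsmul] at h2
  have h3 := congrFun (congrArg torusCoord h2) j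
  rw [map_zsmul, torusCoord_torusBasis, if_pos rfl] at h3
  exact IsUnit.of_mul_eq_one _ h3

/-- The identity trivialization. -/
def refl (B : BlockSystem) (v : B.V) : B.BlockTrivialization v :=
  ⟨Diffeomorph.refl _ _ _, fun _ => rfl⟩

theorem refl_basis {w : B.W} (j : Fin 3) :
    basis (w := w) (refl B w.1) j = torusBasis j := by
  have : onTorus (w := w) (refl B w.1) = ContinuousMap.id _ := rfl
  rw [basis, this, H1.map_id]

end BlockSystem.BlockTrivialization

/-! ### The cyclic graph-manifolds -/

/-- The cyclic system of `k` blocks over two-holed tori. -/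
abbrev cyclicBlocks (k : ℕ) [NeZero k] : BlockSystem where
  V := ZMod k
  Φ _ := twoHoledTorus
  not_disk _ := twoHoledTorus_not_disk
  not_annulus _ := twoHoledTorus_not_annulus
  orientedAtlas _ := holedAtlas
  orientedAtlas_subset _ := IsManifold.subset_maximalAtlas
  orientedAtlas_cover _ p := ⟨_, chart_mem_atlas (EuclideanHalfSpace 2) p, mem_chart_source _ p⟩
  orientedAtlas_pos _ _ hc _ hc' _ hp := holedAtlas_pos hc hc' hp
  bd _ := Bool
  circle _ b := holeCircle b
  circle_smooth _ b := contMDiff_holeCircle b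
  circle_injective _ := holeCircle_injective
  circle_range _ := range_holeCircle
  circle_oriented _ b _ hc _ ht := holeCircle_deriv_neg b hc ht
  rev w := if w.2 then ⟨w.1 + 1, false⟩ else ⟨w.1 - 1, true⟩
  rev_rev w := by
    obtain ⟨i, b⟩ := w
    cases b <;> simp
  rev_ne w := by
    obtain ⟨i, b⟩ := w
    cases b <;> simp

section Cyclic

variable {k : ℕ} [NeZero k]

/-- The directed edge of the cyclic system at the vertex `i`, forward or backward. -/
def cyclicEdge (i : ZMod k) (b : Bool) : (cyclicBlocks k).W := ⟨i, b⟩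

theorem exists_cyclicEdge (w : (cyclicBlocks k).W) : ∃ i b, w = cyclicEdge i b := ⟨w.1, w.2, rfl⟩

theorem rev_cyclicEdge_true (i : ZMod k) :
    (cyclicBlocks k).rev (cyclicEdge i true) = cyclicEdge (i + 1) false := rfl

theorem cyclicBlocks_isCycle : (cyclicBlocks k).IsCycle k := by
  let e : ZMod k × Bool ≃ (cyclicBlocks k).W :=
    { toFun := fun p => if p.2 then cyclicEdge p.1 true else cyclicEdge (p.1 + 1) false
      invFun := fun w => if w.2 then (w.1, true) else (w.1 - 1, false)
      left_inv := by
        rintro ⟨i, b⟩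
        cases b
        · exact Prod.ext (add_sub_cancel_right i 1) rfl
        · rfl
      right_inv := by
        rintro ⟨i, b⟩
        cases b
        · exact congrArg (fun j => cyclicEdge j false) (sub_add_cancel i (1 : ZMod k))
        · rfl }
  exact ⟨Equiv.refl _, e, fun i => ⟨rfl, rfl, rfl⟩⟩

/-- The gluing of the cyclic graph-manifold with parameters `α`. -/
def cyclicGlue (α : ZMod k → ℕ) (i : ZMod k) (b : Bool) : Diffeomorph modelT3 modelT3 T3 T3 ∞ :=
  if b then gluingDiffeo (α i) else (gluingDiffeo (α (i - 1))).symm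

/-- The cyclic graph-manifold with parameters `α`. -/
def cyclicManifold (α : ZMod k → ℕ) : GraphManifold (cyclicBlocks k) where
  glue w := cyclicGlue α w.1 w.2
  glue_rev w := by
    obtain ⟨i, b, rfl⟩ := exists_cyclicEdge w
    cases b
    · rfl
    · change (gluingDiffeo (α (i + 1 - 1))).symm = (gluingDiffeo (α i)).symm
      rw [add_sub_cancel_right]
  glue_det w := by
    obtain ⟨i, b, rfl⟩ := exists_cyclicEdge w
    cases b
    · exact det_homologyMatrix_gluingDiffeo_symm _
    · exact det_homologyMatrix_gluingDiffeo _
  glue_fiber w := by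
    obtain ⟨i, b, rfl⟩ := exists_cyclicEdge w
    cases b
    · exact map_gluingDiffeo_symm_ne _
    · exact map_gluingDiffeo_ne _

theorem cyclicManifold_glueHom_true (α : ZMod k → ℕ) (i : ZMod k) :
    (cyclicManifold α).glueHom (cyclicEdge i true) = H1.map (T3map (gluingDiffeo (α i))) := rfl

theorem cyclicManifold_glueHom_false (α : ZMod k → ℕ) (i : ZMod k) :
    (cyclicManifold α).glueHom (cyclicEdge i false) =
      H1.map (T3map (gluingDiffeo (α (i - 1))).symm) := rfl

theorem cyclicManifold_intersectionNumber (α : ZMod k → ℕ) (w : (cyclicBlocks k).W) :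
    (cyclicManifold α).intersectionNumber w = 1 := by
  obtain ⟨i, b, rfl⟩ := exists_cyclicEdge w
  cases b
  · change Int.gcd (homologyMatrix (gluingDiffeo (α (i - 1))).symm 0 1)
      (homologyMatrix (gluingDiffeo (α (i - 1))).symm 0 2) = 1
    simp [homologyMatrix_apply, torusCoord_gluingDiffeo_symm, torusCoord_torusBasis]
  · change Int.gcd (homologyMatrix (gluingDiffeo (α i)) 0 1)
      (homologyMatrix (gluingDiffeo (α i)) 0 2) = 1
    simp [homologyMatrix_apply, torusCoord_gluingDiffeo, torusCoord_torusBasis]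

/-- Forward edges have lattice `⟨f¹⟩`, and backward edges `⟨f²⟩`. They are distinct and together
generate the fibre group, which gives type 2 and index 1. -/
theorem mem_intersectionLattice_true {α : ZMod k → ℕ} {i : ZMod k} {x : H1 T2} :
    x ∈ (cyclicManifold α).intersectionLattice (cyclicEdge i true) ↔ fiberCoord x 1 = 0 := by
  rw [GraphManifold.intersectionLattice, AddSubgroup.mem_comap, cyclicManifold_glueHom_true,
    mem_map_gluingDiffeo, torusCoord_fiberInclusion]
  rfl

theorem mem_intersectionLattice_false {α : ZMod k → ℕ} {i : ZMod k} {x : H1 T2} :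
    x ∈ (cyclicManifold α).intersectionLattice (cyclicEdge i false) ↔ fiberCoord x 0 = 0 := by
  rw [GraphManifold.intersectionLattice, AddSubgroup.mem_comap, cyclicManifold_glueHom_false,
    mem_map_gluingDiffeo_symm, torusCoord_fiberInclusion]
  rfl

theorem cyclicManifold_type (α : ZMod k → ℕ) (i : (cyclicBlocks k).V) :
    (cyclicManifold α).type i = 2 := by
  have hr : (Set.range fun a : Bool => (cyclicManifold α).intersectionLattice (cyclicEdge i a)) =
      {(cyclicManifold α).intersectionLattice (cyclicEdge i false),
        (cyclicManifold α).intersectionLattice (cyclicEdge i true)} := by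
    ext L
    simp
  change (Set.range fun a : Bool =>
    (cyclicManifold α).intersectionLattice (cyclicEdge i a)).ncard = 2
  rw [hr]
  apply Set.ncard_pair
  intro h
  have h1 : fiberCoord.symm ![1, 0] ∈
      (cyclicManifold α).intersectionLattice (cyclicEdge i true) := by
    rw [mem_intersectionLattice_true, AddEquiv.apply_symm_apply]
    rfl
  rw [← h, mem_intersectionLattice_false, AddEquiv.apply_symm_apply] at h1
  simp at h1

theorem cyclicManifold_secondaryIntersectionNumber (α : ZMod k → ℕ) (i : (cyclicBlocks k).V) :
    (cyclicManifold α).secondaryIntersectionNumber i = 1 := by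
  rw [GraphManifold.secondaryIntersectionNumber, if_pos (cyclicManifold_type α i),
    AddSubgroup.index_eq_one, eq_top_iff]
  intro x _
  have hx : x = fiberCoord.symm ![fiberCoord x 0, 0] + fiberCoord.symm ![0, fiberCoord x 1] := by
    apply fiberCoord.injective
    rw [map_add, AddEquiv.apply_symm_apply, AddEquiv.apply_symm_apply]
    funext j
    fin_cases j <;> simp
  rw [hx]
  have hle (b : Bool) : (cyclicManifold α).intersectionLattice (cyclicEdge i b) ≤
      ⨆ a : (cyclicBlocks k).bd i, (cyclicManifold α).intersectionLattice ⟨i, a⟩ :=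
    le_iSup (fun a : (cyclicBlocks k).bd i => (cyclicManifold α).intersectionLattice ⟨i, a⟩) b
  refine add_mem (hle true ?_) (hle false ?_)
  · rw [mem_intersectionLattice_true, AddEquiv.apply_symm_apply]
    rfl
  · rw [mem_intersectionLattice_false, AddEquiv.apply_symm_apply]
    rfl

theorem cyclicManifold_zero_isOrthogonal :
    (cyclicManifold (k := k) fun _ => 0).IsOrthogonal := by
  refine ⟨fun v => .refl _ v, fun w => ?_⟩
  obtain ⟨i, b, rfl⟩ := exists_cyclicEdge w
  simp only [BlockSystem.BlockTrivialization.refl_basis]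
  cases b
  -- For `α = 0` the inverse gluing is `z ↦ f¹`, `f¹ ↦ f²`, `f² ↦ -z`.
  · refine ⟨⟨![1, 2, 0], ![2, 0, 1], by decide, by decide⟩, ![1, 1, -1], fun j => ?_⟩
    apply torusCoord.injective
    rw [cyclicManifold_glueHom_false, torusCoord_gluingDiffeo_symm, map_zsmul]
    funext l
    fin_cases j <;> fin_cases l <;> simp [torusCoord_torusBasis]
  -- For `α = 0` the gluing is `z ↦ -f²`, `f¹ ↦ z`, `f² ↦ f¹`.
  · refine ⟨⟨![2, 0, 1], ![1, 2, 0], by decide, by decide⟩, ![-1, 1, 1], fun j => ?_⟩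
    apply torusCoord.injective
    rw [cyclicManifold_glueHom_true, torusCoord_gluingDiffeo, map_zsmul]
    funext l
    fin_cases j <;> fin_cases l <;> simp [torusCoord_torusBasis]

instance (v : (cyclicBlocks k).V) : PathConnectedSpace ((cyclicBlocks k).Φ v) :=
  inferInstanceAs (PathConnectedSpace twoHoledTorus)

/-- The global constraint on a block: its two sections cannot be changed independently, since the
boundary circles have opposite winding numbers for every map to the circle. -/
theorem coord_section_add {i : (cyclicBlocks k).V} (τ : (cyclicBlocks k).BlockTrivialization i)
    (l : Fin 2) : τ.coord (a := true) 0 l.succ + τ.coord (a := false) 0 l.succ = 0 := by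
  have h1 := τ.coord_section true l
  have h2 := τ.coord_section false l
  have h3 := winding_holeCircle_add (τ.sectionMap l)
  have : ((τ.coord (a := true) 0 l.succ : ℤ) : ℝ) + τ.coord (a := false) 0 l.succ = 0 := by
    rw [h1, h2]
    exact h3
  exact_mod_cast this

end Cyclic

/-! ### The obstruction to orthogonality -/

/-- An orthogonality relation along an edge forces a fibre basis element at the origin of the edge
to generate the intersection lattice. -/
theorem exists_generator_of_edge {α : ℕ} {b b' : Fin 3 → Fin 3 → ℤ}
    (hb : ∀ j, b j 0 = if 0 = j then 1 else 0) (hb' : ∀ j, b' j 0 = if 0 = j then 1 else 0)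
    (hu : ∀ j (m : ℤ) u, b j = m • u → IsUnit m) (s : Equiv.Perm (Fin 3)) (ε : Fin 3 → ℤˣ)
    (h : ∀ j, ![b' j 1, α * b' j 1 + b' j 2, -b' j 0] = (ε j : ℤ) • b (s j)) :
    ∃ j ≠ 0, b j 2 = 0 ∧ b j 1 ≠ 0 := by
  -- Only one index is sent to `0`, so one of the two fibre elements goes to a fibre element.
  obtain ⟨j, hj, hsj⟩ : ∃ j, j ≠ 0 ∧ s j ≠ 0 := by
    by_cases h1 : s 1 = 0
    · refine ⟨2, by decide, fun h2 => ?_⟩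
      exact absurd (s.injective (h1.trans h2.symm)) (by decide)
    · exact ⟨1, by decide, h1⟩
  have e2 := congrFun (h j) 2
  simp [hb', hj.symm] at e2
  -- The element is a multiple of `f¹`; being part of a basis it is primitive, so the factor is a
  -- unit.
  refine ⟨s j, hsj, e2, (hu (s j) (b (s j) 1) ![0, 1, 0] ?_).ne_zero⟩
  funext l
  fin_cases l <;> simp [hb, hsj.symm, e2]

/-- An orthogonality relation along an edge determines the sections of the trivializations. -/
theorem section_of_edge {α : ℕ} {b b' : Fin 3 → Fin 3 → ℤ}
    (hb : ∀ j, b j 0 = if 0 = j then 1 else 0) (s : Equiv.Perm (Fin 3)) (ε : Fin 3 → ℤˣ)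
    (h : ∀ j, ![b' j 1, α * b' j 1 + b' j 2, -b' j 0] = (ε j : ℤ) • b (s j))
    {j : Fin 3} (hj : j ≠ 0) (hj2 : b' j 2 = 0) (hj1 : b' j 1 ≠ 0) :
    b 0 1 = α ∧ b' 0 1 = 0 := by
  have e0 := congrFun (h j) 0
  have e1 := congrFun (h j) 1
  -- The image of the multiple of `f¹` has nonzero `z`-coordinate, so it cannot be a fibre element
  -- up to sign.
  have hsj : s j = 0 := by
    by_contra hsj
    simp [hb, Ne.symm hsj] at e0
    exact hj1 e0
  have hs0 : s 0 ≠ 0 := fun h0 => hj (s.injective (hsj.trans h0.symm))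
  -- The section of the far block must go to a fibre element, so the `z`-coordinate of its image,
  -- which is its `f¹`-coordinate, vanishes.
  have f0 := congrFun (h 0) 0
  simp [hb, hsj] at e0
  simp [hj2, hsj, e0] at e1
  simp [hb, hs0.symm] at f0
  refine ⟨?_, f0⟩
  rw [mul_comm] at e1
  exact (mul_left_cancel₀ (ε j).ne_zero e1).symm

/-- The cyclic graph-manifold is orthogonal only if all its parameters vanish. -/
theorem cyclicManifold_eq_zero_of_isOrthogonal {k : ℕ} [NeZero k] {α : ZMod k → ℕ}
    (h : (cyclicManifold α).IsOrthogonal) (i : ZMod k) : α i = 0 := by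
  obtain ⟨τ, hτ⟩ := h
  have hedge (i : ZMod k) : ∃ (s : Equiv.Perm (Fin 3)) (ε : Fin 3 → ℤˣ), ∀ j,
      ![(τ (i + 1)).coord false j 1, α i * (τ (i + 1)).coord false j 1 +
        (τ (i + 1)).coord false j 2, -(τ (i + 1)).coord false j 0] =
        (ε j : ℤ) • (τ i).coord true (s j) := by
    obtain ⟨s, ε, hs⟩ := hτ (cyclicEdge i true)
    refine ⟨s, ε, fun j => ?_⟩
    have := congrArg torusCoord (hs j)
    rw [cyclicManifold_glueHom_true, torusCoord_gluingDiffeo, map_zsmul] at this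
    exact this
  have hgen (i : ZMod k) : ∃ j ≠ 0, (τ i).coord true j 2 = 0 ∧ (τ i).coord true j 1 ≠ 0 := by
    obtain ⟨s, ε, hs⟩ := hedge i
    exact exists_generator_of_edge (fun j => (τ i).coord_base true j)
      (fun j => (τ (i + 1)).coord_base false j)
      (fun j m u => (τ i).isUnit_of_coord_eq true j m u) s ε hs
  have hsec (i : ZMod k) : (τ i).coord true 0 1 = α i ∧ (τ (i + 1)).coord false 0 1 = 0 := by
    obtain ⟨s, ε, hs⟩ := hedge i
    -- The generator at the far block comes from the next edge of the cycle; being a fibre class it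
    -- is the same on the torus of the present edge.
    obtain ⟨j, hj, h2, h1⟩ := hgen (i + 1)
    rw [(τ (i + 1)).coord_fiber_eq true false hj] at h1 h2
    exact section_of_edge (fun j => (τ i).coord_base true j) s ε hs hj h2 h1
  -- The forward section of block `i + 1` is controlled by its own edge, the backward one by the
  -- edge from `i`.
  obtain ⟨i, rfl⟩ : ∃ i', i = i' + 1 := ⟨i - 1, by ring⟩
  have h1 := coord_section_add (τ (i + 1)) 0
  have h2 : (τ (i + 1)).coord true 0 1 + (τ (i + 1)).coord false 0 1 = 0 := h1
  rw [(hsec (i + 1)).1, (hsec i).2] at h2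
  exact_mod_cast h2

end

theorem corollary2 (k : ℕ) (hk : 3 ≤ k) :
    ∃ (B : BlockSystem) (M₀ M : GraphManifold B) (w₀ : B.W),
      B.IsCycle k ∧
      (∀ v, Nonempty (B.Φ v ≃ₜ twoHoledTorus)) ∧
      M₀.IsOrthogonal ∧
      (∀ w, w ≠ w₀ → w ≠ B.rev w₀ → M.glue w = M₀.glue w) ∧
      ¬ M.IsOrthogonal ∧
      (∀ v, M.type v = 2) ∧
      (∀ w, M.intersectionNumber w = 1) ∧
      (∀ v, M.secondaryIntersectionNumber v = 1) := by
  have : NeZero k := ⟨by omega⟩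
  -- A single nonzero parameter, so that only the gluing along the edge from `0` to `1` differs from
  -- the orthogonal one.
  let α : ZMod k → ℕ := fun i => if i = 0 then 1 else 0
  refine ⟨cyclicBlocks k, cyclicManifold fun _ => 0, cyclicManifold α, cyclicEdge 0 true,
    cyclicBlocks_isCycle, fun _ => ⟨Homeomorph.refl _⟩, cyclicManifold_zero_isOrthogonal, ?_,
    fun h => ?_, cyclicManifold_type α, cyclicManifold_intersectionNumber α,
    cyclicManifold_secondaryIntersectionNumber α⟩
  · intro w h1 h2
    rw [rev_cyclicEdge_true] at h2
    obtain ⟨i, b, rfl⟩ := exists_cyclicEdge w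
    cases b
    -- The backward edge at `i` carries the parameter of `i - 1`; the excluded case `i = 1` is the
    -- reverse of the modified edge.
    · have hi : i - 1 ≠ 0 := fun hi => h2 (by rw [sub_eq_zero.1 hi, zero_add])
      change (gluingDiffeo (α (i - 1))).symm = (gluingDiffeo 0).symm
      simp only [α, if_neg hi]
    · have hi : i ≠ 0 := fun hi => h1 (by rw [hi])
      change gluingDiffeo (α i) = gluingDiffeo 0
      simp only [α, if_neg hi]
  · simpa [α] using cyclicManifold_eq_zero_of_isOrthogonal h 0
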